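/- Let $M$ be a complex manifold of complex dimension $n\ge 2$ with a Hermitian metric $\langle\cdot,\cdot\rangle$ (of class at least $C^2$) and Chern connection $\nabla$ on $\mathbb{C}T(M)$. Let $\Omega\subset M$ be a relatively compact pseudoconvex domain with $C^2$ boundary, let $U$ be an open neighborhood of $\partial\Omega$, and let $r\in C^2(U)$ be an admissible defining function for $\Omega$: $\Omega\cap U=\{r<0\}$, $dr\neq 0$ on $U$, and $|dr|\in C^2(U)$. Let $X_r$ be the real $C^1$ vector field on $U$ with $|dr|^{-2}dr(Y)=\langle Y,X_r\rangle$ for all real $Y$, let $L_r$ be the $C^1$ section of $T^{1,0}(U)$ with $|\partial r|^{-2}\partial r(Z)=\langle Z,L_r\rangle$ for all $Z\in T^{1,0}(U)$, and let $\alpha_r$ be the continuous real $1$-form on $U$ with $\alpha_r(Z)=\partial\bar\partial r(Z,\bar L_r)$ and $\alpha_r(\bar Z)=\partial\bar\partial r(L_r,\bar Z)$ for $Z\in T^{1,0}(U)$. Put $\mathrm{Hess}_\nabla(X,Y)=XY-\nabla_XY$ and $$H^3_\nabla(X_1,X_2,X_3)=X_1\,\mathrm{Hess}_\nabla(X_2,X_3)-\mathrm{Hess}_\nabla(\nabla_{X_1}X_2,X_3)-\mathrm{Hess}_\nabla(X_2,\nabla_{X_1}X_3),$$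 where all tensors are extended $\mathbb{C}$-linearly, $\mathrm{Hess}_\nabla$ is tensorial in both arguments, $H^3_\nabla$ is tensorial in $X_2,X_3$, and the outer derivative in $H^3_\nabla(X_r,\cdot,\cdot)r$ is taken along the integral curves of $X_r$. For $P\in\partial\Omega$ let $\mathcal{N}_P(\partial\Omega)$ be the null space of the Levi form: the set of $Z\in T^{1,0}_P(M)$ with $\partial r(Z)=0$ such that $\partial\bar\partial r(Z,\bar W)=0$ for all $W\in T^{1,0}_P(M)$ with $\partial r(W)=0$. Then there is a continuous real-valued $2$-form $\beta_r$ on $U$ with $$\beta_r=-\tfrac{i}{2}\left(\partial\alpha_r-\bar\partial\alpha_r\right)$$ on $U$ in the weak sense, and for all $P\in\partial\Omega$ and $Z,W\in\mathcal{N}_P(\partial\Omega)$ the derivative $H^3_\nabla(X_r,Z,\bar W)r$ exists at $P$, $$\beta_r(Z,W)=0,$$ and $$\beta_r(Z,\bar W)=-iH^3_\nabla(X_r,Z,\bar W)r-i\alpha_r(Z)\alpha_r(\bar W)+i\left(\mathrm{Hess}_\nabla(X_r,Z)r\right)\alpha_r(\bar W)+i\alpha_r(Z)\left(\mathrm{Hess}_\nabla(X_r,\bar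 W)r\right).$$ -/

import Mathlib

open scoped Manifold ContDiff Matrix

noncomputable section

/-! ## Complexified tangent vectors in a holomorphic chart -/

/-- The model space `ℂⁿ`. (Its norm only serves to define derivatives.) -/
abbrev Cn (n : ℕ) : Type := Fin n → ℂ

/-- A vector of the complexified tangent space of `ℂⁿ = ℝ²ⁿ`, written through its `(1,0)` and
`(0,1)` parts: `⟨a, b⟩` is `∑ⱼ aⱼ ∂/∂zⱼ + ∑ⱼ conj(bⱼ) ∂/∂z̄ⱼ`. -/
structure CVec (n : ℕ) where
  /-- coordinates of the `(1,0)` part -/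
  hol : Cn n
  /-- coordinates of the complex conjugate of the `(0,1)` part -/
  anti : Cn n

namespace CVec

variable {n : ℕ}

/-- The `(1,0)` vector `Z_a = ∑ⱼ aⱼ ∂/∂zⱼ`. -/
def ofHol (a : Cn n) : CVec n := ⟨a, 0⟩

/-- Complex conjugation of a complexified tangent vector. -/
def conj (u : CVec n) : CVec n := ⟨u.anti, u.hol⟩

/-- The real tangent vector `x ∈ ℂⁿ = ℝ²ⁿ` as a complexified one,
`∑ⱼ xⱼ ∂/∂zⱼ + ∑ⱼ conj(xⱼ) ∂/∂z̄ⱼ`. -/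
def ofReal (x : Cn n) : CVec n := ⟨x, x⟩

/-- The `(1,0)` part. -/
def holPart (u : CVec n) : CVec n := ⟨u.hol, 0⟩

/-- The `(0,1)` part. -/
def antiPart (u : CVec n) : CVec n := ⟨0, u.anti⟩

/-- The real part: `u = re u + i im u` with real tangent vectors `re u`, `im u`, since
`Z_a = (a - i J a) / 2` where `J` is multiplication by `i` on `ℂⁿ`. -/
def re (u : CVec n) : Cn n := (1 / 2 : ℂ) • (u.hol + u.anti)

/-- The imaginary part, see `CVec.re`. -/
def im (u : CVec n) : Cn n := (1 / 2 : ℂ) • (Complex.I • (u.anti - u.hol))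

end CVec

section LocalCalculus

variable {n : ℕ}

/-- The derivative `u f` of a complex valued function at `z` along a complexified vector `u`
(so `∂/∂zⱼ f` for `u = ofHol (Pi.single j 1)`). -/
def cderiv (f : Cn n → ℂ) (z : Cn n) (u : CVec n) : ℂ :=
  fderiv ℝ f z u.re + Complex.I * fderiv ℝ f z u.im

/-- The `ℂ`-bilinear extension of a real bilinear form `B` to complexified tangent vectors. -/
def complexify (B : Cn n → Cn n → ℝ) (u v : CVec n) : ℂ :=
  ((B u.re v.re - B u.im v.im : ℝ) : ℂ) + Complex.I * ((B u.re v.im + B u.im v.re : ℝ) : ℂ)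

/-- The complex Hessian `∂∂̄ f (Z_a, conj Z_b) = ∑ aⱼ conj(b_k) ∂²f/∂zⱼ∂z̄_k` at `z`. -/
def deldelbar (f : Cn n → ℂ) (z a b : Cn n) : ℂ :=
  cderiv (fun w => cderiv f w (CVec.ofHol b).conj) z (CVec.ofHol a)

/-! ### The Chern connection

`G z j k = ⟨∂/∂zⱼ, ∂/∂z_k⟩` is the coordinate matrix of a Hermitian metric. -/

/-- The coordinates of `∇_{Z_a} Z_b` for constant `a`, `b`: the `(1,0)` vector with
`⟨∇_{Z_a} Z_b, ∂/∂z_k⟩ = Z_a ⟨Z_b, ∂/∂z_k⟩` for all `k`. -/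
def christoffel (G : Cn n → Matrix (Fin n) (Fin n) ℂ) (z a b : Cn n) : Cn n :=
  (b ᵥ* (Matrix.of fun j k => cderiv (fun w => G w j k) z (CVec.ofHol a))) ᵥ* (G z)⁻¹

/-- `∇_u v` at `z` for the Chern connection on the complexified tangent bundle, where `v` is
extended with constant coordinates. As coordinate fields are holomorphic, `∇_{conj W} Z = 0`
for constant `(1,0)` fields; the connection commutes with complex conjugation. -/
def covConst (G : Cn n → Matrix (Fin n) (Fin n) ℂ) (z : Cn n) (u v : CVec n) : CVec n :=
  ⟨christoffel G z u.hol v.hol, christoffel G z u.anti v.anti⟩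

/-- The Hessian tensor `Hess_∇(u, v) f = u v f - (∇_u v) f` at `z`. Its value depends only on `u`
and `v` at the point, so it is computed with `v` extended with constant coordinates. -/
def hess (G : Cn n → Matrix (Fin n) (Fin n) ℂ) (f : Cn n → ℂ) (z : Cn n) (u v : CVec n) : ℂ :=
  cderiv (fun w => cderiv f w v) z u - cderiv f z (covConst G z u v)

/-- `X f` exists at `z` and equals `d`, for a real vector field `X` with coordinates `x` and a
function `f` that need not be differentiable: `f` is differentiable along the integral curve of
`X` through `z`. -/
def HasDerivAlong (x : Cn n → Cn n) (f : Cn n → ℂ) (z : Cn n) (d : ℂ) : Prop :=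
  (∃ γ : ℝ → Cn n, γ 0 = z ∧ IsIntegralCurveAt γ (fun _ => x) 0) ∧
    ∀ γ : ℝ → Cn n, γ 0 = z → IsIntegralCurveAt γ (fun _ => x) 0 →
      HasDerivAt (fun t => f (γ t)) d 0

/-- `H³_∇(X, u, v) f` exists at `z` and equals `c`, for a real vector field `X` with coordinates
`x`, where
`H³_∇(X, u, v) = X Hess_∇(u, v) - Hess_∇(∇_X u, v) - Hess_∇(u, ∇_X v)`.
It is tensorial in `u` and `v`, so it is computed with `u`, `v` extended with constant
coordinates. -/
def HasThirdHess (G : Cn n → Matrix (Fin n) (Fin n) ℂ) (f : Cn n → ℂ) (x : Cn n → Cn n)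
    (z : Cn n) (u v : CVec n) (c : ℂ) : Prop :=
  ∃ d : ℂ, HasDerivAlong x (fun w => hess G f w u v) z d ∧
    c = d - hess G f z (covConst G z (CVec.ofReal (x z)) u) v
      - hess G f z u (covConst G z (CVec.ofReal (x z)) v)

/-! ### The vector fields `X_r`, `L_r` and the form `α_r` of a real function `ρ` -/

/-- A real function, regarded as complex valued. -/
def toC (ρ : Cn n → ℝ) : Cn n → ℂ := fun z => (ρ z : ℂ)

/-- The Hermitian inner product `⟨Z_a, Z_b⟩`, linear in the first argument. -/
def herm (G : Cn n → Matrix (Fin n) (Fin n) ℂ) (z a b : Cn n) : ℂ :=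
  ∑ j, ∑ k, a j * star (b k) * G z j k

/-- The Riemannian metric on real tangent vectors, `⟨a, b⟩ = 2 Re ⟨Z_a, Z_b⟩`
(because `a = Z_a + conj Z_a`). -/
def riem (G : Cn n → Matrix (Fin n) (Fin n) ℂ) (z a b : Cn n) : ℝ := 2 * (herm G z a b).re

/-- The coefficients `∂ρ/∂zⱼ`. -/
def delCoeff (ρ : Cn n → ℝ) (z : Cn n) : Cn n :=
  fun j => cderiv (toC ρ) z (CVec.ofHol (Pi.single j 1))

/-- The coordinates of the gradient of `ρ`: the vector `N` with `∂ρ(Z_a) = ⟨Z_a, Z_N⟩` for all `a`;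
equivalently, `dρ(a) = ⟨a, N⟩` for all real tangent vectors `a`. -/
def gradVec (G : Cn n → Matrix (Fin n) (Fin n) ℂ) (ρ : Cn n → ℝ) (z : Cn n) : Cn n :=
  star ((G z)⁻¹ *ᵥ delCoeff ρ z)

/-- `|∂ρ|²`, the squared norm of the functional `∂ρ` on `(1,0)` vectors, that is, of the vector
that represents it. -/
def normSqDel (G : Cn n → Matrix (Fin n) (Fin n) ℂ) (ρ : Cn n → ℝ) (z : Cn n) : ℝ :=
  (herm G z (gradVec G ρ z) (gradVec G ρ z)).re

/-- `|dρ|²`, the squared norm of the functional `dρ` on real tangent vectors, that is, of the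
vector that represents it. -/
def normSqD (G : Cn n → Matrix (Fin n) (Fin n) ℂ) (ρ : Cn n → ℝ) (z : Cn n) : ℝ :=
  riem G z (gradVec G ρ z) (gradVec G ρ z)

/-- The coordinates of the real vector field `X` with `|dρ|⁻² dρ(Y) = ⟨Y, X⟩` for all `Y`. -/
def vecX (G : Cn n → Matrix (Fin n) (Fin n) ℂ) (ρ : Cn n → ℝ) (z : Cn n) : Cn n :=
  (((normSqD G ρ z)⁻¹ : ℝ) : ℂ) • gradVec G ρ z

/-- The coordinates of the `(1,0)` vector field `L` with `|∂ρ|⁻² ∂ρ(Z) = ⟨Z, L⟩` for all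
`(1,0)` vectors `Z`. -/
def vecL (G : Cn n → Matrix (Fin n) (Fin n) ℂ) (ρ : Cn n → ℝ) (z : Cn n) : Cn n :=
  (((normSqDel G ρ z)⁻¹ : ℝ) : ℂ) • gradVec G ρ z

/-- The one-form `α`: `α(Z) = ∂∂̄ρ(Z, conj L)` and `α(conj Z) = ∂∂̄ρ(L, conj Z)` for `(1,0)`
vectors `Z`, extended `ℂ`-linearly. -/
def alphaForm (G : Cn n → Matrix (Fin n) (Fin n) ℂ) (ρ : Cn n → ℝ) (z : Cn n) (u : CVec n) : ℂ :=
  deldelbar (toC ρ) z u.hol (vecL G ρ z) + deldelbar (toC ρ) z (vecL G ρ z) u.anti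

/-- The `(1,0)` vectors tangent to the level set of `ρ` through `z`: those with `∂ρ(Z_a) = 0`. -/
def holTangent (ρ : Cn n → ℝ) (z : Cn n) : Set (Cn n) :=
  {a | cderiv (toC ρ) z (CVec.ofHol a) = 0}

/-- The null space of the Levi form of the level set of `ρ` through `z`. -/
def leviNull (ρ : Cn n → ℝ) (z : Cn n) : Set (Cn n) :=
  {a | a ∈ holTangent ρ z ∧ ∀ b ∈ holTangent ρ z, deldelbar (toC ρ) z a b = 0}

/-! ### Distributional `∂` and `∂̄` of a one-form

For constant `u`, `v`, writing `u'`, `u''` for the `(1,0)` and `(0,1)` parts,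
`∂α(u, v) = u' (α(v)) - v' (α(u))` and `∂̄α(u, v) = u'' (α(v)) - v'' (α(u))`. -/

/-- The distribution `∂α(u, v)` applied to the test function `χ`. -/
def delWeak (α : Cn n → CVec n → ℂ) (u v : CVec n) (χ : Cn n → ℝ) : ℂ :=
  -∫ z, (cderiv (toC χ) z u.holPart * α z v - cderiv (toC χ) z v.holPart * α z u)

/-- The distribution `∂̄α(u, v)` applied to the test function `χ`. -/
def delbarWeak (α : Cn n → CVec n → ℂ) (u v : CVec n) (χ : Cn n → ℝ) : ℂ :=
  -∫ z, (cderiv (toC χ) z u.antiPart * α z v - cderiv (toC χ) z v.antiPart * α z u)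

/-- The continuous two-form `B` satisfies `B = -(i/2)(∂α - ∂̄α)` on the open set `V ⊆ ℂⁿ` in the
weak sense. -/
def WeakBetaEq (V : Set (Cn n)) (α : Cn n → CVec n → ℂ) (B : Cn n → Cn n → Cn n → ℝ) : Prop :=
  ∀ χ : Cn n → ℝ, ContDiff ℝ ∞ χ → HasCompactSupport χ → tsupport χ ⊆ V →
    ∀ u v : CVec n,
      ∫ z, (χ z : ℂ) * complexify (B z) u v =
        -(Complex.I / 2) * (delWeak α u v χ - delbarWeak α u v χ)

end LocalCalculus

/-! ## Objects on a complex manifold -/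

section Manifold

variable (n : ℕ) (M : Type*) [TopologicalSpace M] [ChartedSpace (Cn n) M]

/-- The holomorphic charts of a complex manifold. -/
abbrev holCharts : Set (OpenPartialHomeomorph M (Cn n)) :=
  IsManifold.maximalAtlas 𝓘(ℂ, Cn n) ω M

variable {n M}

/-- The real tangent vector at `φ⁻¹ z` with coordinates `a ∈ ℂⁿ = ℝ²ⁿ` in the chart `φ`. The complex
structure of `TangentSpace` is `J`. -/
def coordVec (φ : OpenPartialHomeomorph M (Cn n)) (z a : Cn n) :
    TangentSpace 𝓘(ℂ, Cn n) (φ.symm z) :=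
  mfderiv 𝓘(ℂ, Cn n) 𝓘(ℂ, Cn n) φ.symm z a

variable (n M)

/-- A Hermitian metric of class `C²`. The value `form p v w` is `⟨Z_v, Z_w⟩`, where
`Z_v = (v - i J v) / 2` is the `(1,0)` vector of `v`. -/
structure HermitianMetric where
  form : ∀ p : M, TangentSpace 𝓘(ℂ, Cn n) p →ₗ[ℂ] TangentSpace 𝓘(ℂ, Cn n) p →ₗ⋆[ℂ] ℂ
  herm_symm : ∀ p v w, form p w v = star (form p v w)
  pos : ∀ p v, v ≠ 0 → 0 < (form p v v).re
  contDiff : ∀ φ ∈ holCharts n M, ∀ j k : Fin n,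
    ContDiffOn ℝ 2 (fun z => form (φ.symm z) (coordVec φ z (Pi.single j 1))
      (coordVec φ z (Pi.single k 1))) φ.target

variable {n M}

/-- The coordinate matrix `⟨∂/∂zⱼ, ∂/∂z_k⟩` of a Hermitian metric in a chart. -/
def HermitianMetric.matrix (g : HermitianMetric n M) (φ : OpenPartialHomeomorph M (Cn n))
    (z : Cn n) : Matrix (Fin n) (Fin n) ℂ :=
  Matrix.of fun j k => g.form (φ.symm z) (coordVec φ z (Pi.single j 1))
    (coordVec φ z (Pi.single k 1))

/-- The part of the range of the chart that corresponds to `U`. -/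
def chartDomain (φ : OpenPartialHomeomorph M (Cn n)) (U : Set M) : Set (Cn n) :=
  φ.target ∩ φ.symm ⁻¹' U

/-- A function on `M` in a chart. -/
def inChart (φ : OpenPartialHomeomorph M (Cn n)) (r : M → ℝ) : Cn n → ℝ := fun z => r (φ.symm z)

/-- A field of real two-forms on `M` in a chart. -/
def formInChart (β : ∀ p : M, TangentSpace 𝓘(ℂ, Cn n) p [⋀^Fin 2]→ₗ[ℝ] ℝ)
    (φ : OpenPartialHomeomorph M (Cn n)) (z a b : Cn n) : ℝ :=
  β (φ.symm z) ![coordVec φ z a, coordVec φ z b]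

/-- A relatively compact domain. -/
structure IsRelCompactDomain (Ω : Set M) : Prop where
  isOpen : IsOpen Ω
  isConnected : IsConnected Ω
  isCompact_closure : IsCompact (closure Ω)

variable (n)

/-- `r` is a `C²` defining function for `Ω` on the open neighborhood `U` of `∂Ω` (in particular `Ω`
has `C²` boundary). As usual, `U` is so small that `dr` has no zeros on `U`. -/
structure IsDefiningFunction (Ω U : Set M) (r : M → ℝ) : Prop where
  isOpen : IsOpen U
  frontier_subset : frontier Ω ⊆ U
  contDiffOn : ∀ φ ∈ holCharts n M, ContDiffOn ℝ 2 (inChart φ r) (chartDomain φ U)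
  mem_iff : ∀ p ∈ U, p ∈ Ω ↔ r p < 0
  fderiv_ne_zero : ∀ φ ∈ holCharts n M, ∀ z ∈ chartDomain φ U, fderiv ℝ (inChart φ r) z ≠ 0

/-- Levi pseudoconvexity of a domain with `C²` boundary. -/
def IsLeviPseudoconvex (Ω : Set M) : Prop :=
  ∃ (V : Set M) (ρ : M → ℝ), IsDefiningFunction n Ω V ρ ∧
    ∀ φ ∈ holCharts n M, ∀ z ∈ chartDomain φ (frontier Ω), ∀ a ∈ holTangent (inChart φ ρ) z,
      0 ≤ (deldelbar (toC (inChart φ ρ)) z a a).re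

variable {n}

/-- Admissibility of a defining function on `U`: `|dr|` is of class `C²` on `U`. -/
def HermitianMetric.IsAdmissible (g : HermitianMetric n M) (U : Set M) (r : M → ℝ) : Prop :=
  ∀ φ ∈ holCharts n M,
    ContDiffOn ℝ 2 (fun z => Real.sqrt (normSqD (g.matrix φ) (inChart φ r) z)) (chartDomain φ U)

end Manifold

end

/-!
Write `L` for the coordinates of `L_r`, so that `X_r` has coordinates `L / 2`. The form `α` involves
second derivatives of a `C²` function and is merely continuous; two facts give `α` a continuous
exterior derivative of the kind needed.

* Differentiating `|∂r|² = ∑ Gʲᵏ rⱼ r_k̄`, with `|∂r|²` of class `C²` because `r` is admissible, shows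
  that the derivatives `L (∂r/∂z_m)` are of class `C¹`
  (`IsHermitianMatrixField.fderiv_delCoeff_gradVec`, `IsHermitianMatrixField.isTransverse`).
* Hence `α' - α''`, the difference of the `(1,0)` and `(0,1)` parts of `α`, is a finite sum
  `∑ Fᵢ dGᵢ` with `Fᵢ`, `Gᵢ` of class `C¹` (`IsTransverse.formOne_potential`), and the weak exterior
  derivative of such a form is the continuous form `∑ dFᵢ ∧ dGᵢ` (`integral_test_mul_formTwo`).

As `(∂α - ∂̄α)(u, v) = -d(α' - α'')(Ju, Jv)`, this gives `β` in every chart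
(`IsTransverse.weakBetaEq`). Since `d(∑ Fᵢ dGᵢ)` is determined by the one-form
(`formTwo_eq_of_formOne_eq`) and `∂∂̄r` is invariant under holomorphic maps, `β` does not depend on the
chart (`betaLocal_comp_holomorphic`); the same uniqueness shows that `β` is real.

If `u`, a vector field `X` and `X u` are `C¹`, difference quotients show that every derivative `v u` is
differentiable along the integral curves of `X`, with derivative `v (X u) - (v X) u`
(`hasDerivAt_fderiv_comp_of_isIntegralCurveAt`). Applied to `u = ∂r/∂z̄_k`, this provides the third
derivatives in `H³`. At a null vector `Z` of the Levi form `∂∂̄r(Z, ·) = α(Z) ∂̄r`, and both formulas for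
`β` become algebra, based on the derivatives of `∂r(L) = 1`
(`IsTransverse.complexify_betaLocal_ofHol`, `exists_hasThirdHess`).
-/

open MeasureTheory Filter Topology

noncomputable section

/-! ### Exterior derivatives of `∑ᵢ Fᵢ dGᵢ` for functions of class `C¹` -/

section WeakCalculus

variable {E : Type*} [NormedAddCommGroup E] [NormedSpace ℝ E]

theorem continuous_fderiv_apply_const {F : E → ℂ} (hF : ContDiff ℝ 1 F) (a : E) :
    Continuous fun x => fderiv ℝ F x a :=
  (hF.continuous_fderiv one_ne_zero).clm_apply continuous_const

/-- A function of class `Cᵏ` on an open set, cut off by a test function, is `Cᵏ` everywhere. -/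
theorem contDiff_mul_of_tsupport_subset {V : Set E} (hV : IsOpen V) {k : ℕ∞}
    {f : E → ℂ} (hf : ContDiffOn ℝ k f V) {χ : E → ℝ} (hχ : ContDiff ℝ k χ)
    (hs : tsupport χ ⊆ V) : ContDiff ℝ k fun x => (χ x : ℂ) * f x := by
  rw [contDiff_iff_contDiffAt]
  intro x
  by_cases hx : x ∈ tsupport χ
  · exact (Complex.ofRealCLM.contDiff.contDiffAt.comp x hχ.contDiffAt).mul
      (hf.contDiffAt (hV.mem_nhds (hs hx)))
  · have h0 : (fun y => (χ y : ℂ) * f y) =ᶠ[𝓝 x] fun _ => 0 := by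
      filter_upwards [(isClosed_tsupport χ).isOpen_compl.mem_nhds hx] with y hy
      simp [image_eq_zero_of_notMem_tsupport hy]
    exact contDiffAt_const.congr_of_eventuallyEq h0

theorem continuous_mul_of_tsupport_subset {X : Type*} [TopologicalSpace X] {V : Set X} (hV : IsOpen V)
    {f : X → ℂ} (hf : ContinuousOn f V) {χ : X → ℂ} (hχ : Continuous χ)
    (hs : tsupport χ ⊆ V) : Continuous fun x => χ x * f x := by
  rw [continuous_iff_continuousAt]
  intro x
  by_cases hx : x ∈ tsupport χ
  · exact hχ.continuousAt.mul (hf.continuousAt (hV.mem_nhds (hs hx)))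
  · have h0 : (fun y => χ y * f y) =ᶠ[𝓝 x] fun _ => 0 := by
      filter_upwards [(isClosed_tsupport χ).isOpen_compl.mem_nhds hx] with y hy
      simp [image_eq_zero_of_notMem_tsupport hy]
    exact continuousAt_const.congr h0.symm

theorem integrable_mul_of_tsupport_subset {X : Type*} [TopologicalSpace X] [MeasurableSpace X]
    [OpensMeasurableSpace X] (μ : Measure X) [IsFiniteMeasureOnCompacts μ] {V : Set X} (hV : IsOpen V)
    {f : X → ℂ} (hf : ContinuousOn f V) {χ : X → ℂ} (hχ : Continuous χ)
    (hc : HasCompactSupport χ) (hs : tsupport χ ⊆ V) : Integrable (fun x => χ x * f x) μ :=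
  (continuous_mul_of_tsupport_subset hV hf hχ hs).integrable_of_hasCompactSupport hc.mul_right

/-- A smooth cutoff function that is `1` near a compact subset of an open set. -/
theorem exists_cutoff [FiniteDimensional ℝ E] {V K : Set E} (hV : IsOpen V) (hK : IsCompact K) (hKV : K ⊆ V) :
    ∃ ψ : E → ℝ, ContDiff ℝ ∞ ψ ∧ HasCompactSupport ψ ∧ tsupport ψ ⊆ V ∧
      ∀ᶠ x in 𝓝ˢ K, ψ x = 1 := by
  obtain ⟨K', hK', hKK', hK'V⟩ := exists_compact_between hK hV hKV
  obtain ⟨ψ, h1, h0, -⟩ := exists_contMDiffMap_one_nhds_of_subset_interior (n := ⊤) 𝓘(ℝ, E)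
    hK.isClosed hKK'
  have hsub : tsupport ψ ⊆ K' := closure_minimal
    (fun x hx => by_contra fun h => hx (h0 x h)) hK'.isClosed
  exact ⟨ψ, ψ.contMDiff.contDiff, hK'.of_isClosed_subset (isClosed_tsupport _) hsub, hsub.trans hK'V, h1⟩

/-- The one-form `∑ᵢ Fᵢ dGᵢ`. -/
def formOne {ι : Type*} [Fintype ι] (F G : ι → E → ℂ) (x a : E) : ℂ :=
  ∑ i, F i x * fderiv ℝ (G i) x a

/-- The two-form `∑ᵢ dFᵢ ∧ dGᵢ`, the exterior derivative of `formOne F G`. -/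
def formTwo {ι : Type*} [Fintype ι] (F G : ι → E → ℂ) (x a b : E) : ℂ :=
  ∑ i, (fderiv ℝ (F i) x a * fderiv ℝ (G i) x b - fderiv ℝ (F i) x b * fderiv ℝ (G i) x a)

variable {ι : Type*} [Fintype ι] {F G : ι → E → ℂ} {V : Set E}

theorem continuousOn_formOne (hV : IsOpen V) (hF : ∀ i, ContDiffOn ℝ 1 (F i) V)
    (hG : ∀ i, ContDiffOn ℝ 1 (G i) V) (a : E) : ContinuousOn (fun x => formOne F G x a) V :=
  continuousOn_finsetSum _ fun i _ => (hF i).continuousOn.mul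
    (((hG i).continuousOn_fderiv_of_isOpen hV le_rfl).clm_apply continuousOn_const)

theorem continuousOn_formTwo (hV : IsOpen V) (hF : ∀ i, ContDiffOn ℝ 1 (F i) V)
    (hG : ∀ i, ContDiffOn ℝ 1 (G i) V) (a b : E) :
    ContinuousOn (fun x => formTwo F G x a b) V := by
  have h : ∀ {f : E → ℂ} (c : E), ContDiffOn ℝ 1 f V → ContinuousOn (fun x => fderiv ℝ f x c) V :=
    fun c hf => (hf.continuousOn_fderiv_of_isOpen hV le_rfl).clm_apply continuousOn_const
  exact continuousOn_finsetSum _ fun i _ =>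
    ((h a (hF i)).mul (h b (hG i))).sub ((h b (hF i)).mul (h a (hG i)))

variable [MeasurableSpace E] [BorelSpace E] (μ : Measure E)

variable [μ.IsAddHaarMeasure]

theorem hasDerivAt_integral_translate_mul {F g : E → ℂ} (hF : ContDiff ℝ 1 F)
    (hFs : HasCompactSupport F) (hg : Continuous g) (hgs : HasCompactSupport g) (a : E) :
    HasDerivAt (fun t : ℝ => ∫ x, F (x + t • a) * g x ∂μ) (∫ x, fderiv ℝ F x a * g x ∂μ) 0 := by
  obtain ⟨C, hC⟩ := (hF.continuous_fderiv one_ne_zero).bounded_above_of_compact_support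
    (hFs.fderiv (𝕜 := ℝ))
  have hcont : ∀ t : ℝ, Continuous fun x => F (x + t • a) * g x := fun t =>
    (hF.continuous.comp (by fun_prop)).mul hg
  have key := hasDerivAt_integral_of_dominated_loc_of_deriv_le (μ := μ) (𝕜 := ℝ)
    (F := fun t x => F (x + t • a) * g x) (F' := fun t x => fderiv ℝ F (x + t • a) a * g x)
    (x₀ := (0 : ℝ)) (s := Set.univ) (bound := fun x => C * ‖a‖ * ‖g x‖) Filter.univ_mem
    (Eventually.of_forall fun t => (hcont t).aestronglyMeasurable)
    ((hcont 0).integrable_of_hasCompactSupport hgs.mul_left)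
    (((continuous_fderiv_apply_const hF a).comp (by fun_prop)).mul hg).aestronglyMeasurable
    (Eventually.of_forall fun x t _ => by
      rw [norm_mul]
      gcongr
      exact (ContinuousLinearMap.le_opNorm _ _).trans (by gcongr; exact hC _))
    ((hg.integrable_of_hasCompactSupport hgs).norm.const_mul _)
    (Eventually.of_forall fun x t _ => by
      have h1 : HasDerivAt (fun t : ℝ => x + t • a) a t := by
        simpa using ((hasDerivAt_id t).smul_const a).const_add x
      exact (((hF.differentiable one_ne_zero _).hasFDerivAt.comp_hasDerivAt t h1)).mul_const _)
  simpa using key.2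

variable [FiniteDimensional ℝ E]

/-- For `F`, `G` merely of class `C¹`, the exact form `d(F dG)` integrates to zero. As `dF ∧ dG` has no
derivative to integrate by parts, the translates of `F` in the direction `a` are integrated by
parts in the direction `b`, and the resulting identity is differentiated in the translation. -/
theorem integral_fderiv_mul_fderiv_comm {F G : E → ℂ} (hF : ContDiff ℝ 1 F)
    (hFs : HasCompactSupport F) (hG : ContDiff ℝ 1 G) (hGs : HasCompactSupport G) (a b : E) :
    ∫ x, fderiv ℝ F x a * fderiv ℝ G x b ∂μ = ∫ x, fderiv ℝ F x b * fderiv ℝ G x a ∂μ := by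
  have cF := continuous_fderiv_apply_const hF b
  have cG := continuous_fderiv_apply_const hG b
  have sF : HasCompactSupport fun x => fderiv ℝ F x b := hFs.fderiv_apply (𝕜 := ℝ) b
  have sG : HasCompactSupport fun x => fderiv ℝ G x b := hGs.fderiv_apply (𝕜 := ℝ) b
  have h1 := hasDerivAt_integral_translate_mul μ hF hFs cG sG a
  have h2 := hasDerivAt_integral_translate_mul μ hG hGs cF sF (-a)
  have heq : (fun t : ℝ => ∫ x, F (x + t • a) * fderiv ℝ G x b ∂μ)
      = fun t : ℝ => -∫ x, G (x + t • (-a)) * fderiv ℝ F x b ∂μ := by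
    funext t
    have hFt : ContDiff ℝ 1 fun x => F (x + t • a) := hF.comp (by fun_prop)
    have hd : ∀ x, fderiv ℝ (fun x => F (x + t • a)) x = fderiv ℝ F (x + t • a) := fun x =>
      fderiv_comp_add_right _
    rw [integral_mul_fderiv_eq_neg_fderiv_mul_of_integrable
      (f := fun x => F (x + t • a)) (g := G) (v := b)]
    · congr 1
      rw [← integral_add_right_eq_self (fun x => G (x + t • -a) * fderiv ℝ F x b) (t • a)]
      refine integral_congr_ae (Eventually.of_forall fun x => ?_)
      simp only [hd, smul_neg, add_neg_cancel_right, mul_comm (G x)]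
    · exact ((continuous_fderiv_apply_const hFt b).mul hG.continuous).integrable_of_hasCompactSupport
        hGs.mul_left
    · exact (hFt.continuous.mul cG).integrable_of_hasCompactSupport sG.mul_left
    · exact (hFt.continuous.mul hG.continuous).integrable_of_hasCompactSupport hGs.mul_left
    · exact fun x _ => hFt.differentiable one_ne_zero x
    · exact fun x _ => hG.differentiable one_ne_zero x
  rw [heq] at h1
  have h3 := h1.unique h2.neg
  rw [h3, ← integral_neg]
  refine integral_congr_ae (Eventually.of_forall fun x => ?_)
  simp [mul_comm]

/-- `d(f dg) = df ∧ dg` in the weak sense, for `f` and `g` of class `C¹`. -/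
theorem integral_test_mul_wedge (hV : IsOpen V) {f g : E → ℂ} (hf : ContDiffOn ℝ 1 f V)
    (hg : ContDiffOn ℝ 1 g V) {χ : E → ℝ} (hχ : ContDiff ℝ ∞ χ) (hc : HasCompactSupport χ)
    (hs : tsupport χ ⊆ V) (a b : E) :
    ∫ x, (((χ x : ℂ) * (fderiv ℝ f x a * fderiv ℝ g x b - fderiv ℝ f x b * fderiv ℝ g x a))
      + ((fderiv ℝ χ x a : ℂ) * (f x * fderiv ℝ g x b)
        - (fderiv ℝ χ x b : ℂ) * (f x * fderiv ℝ g x a))) ∂μ = 0 := by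
  obtain ⟨ψ, hψ, hψc, hψs, hψ1⟩ := exists_cutoff hV hc hs
  have hF : ContDiff ℝ 1 fun x => (χ x : ℂ) * f x :=
    contDiff_mul_of_tsupport_subset (k := 1) hV hf (hχ.of_le (by simp)) hs
  have hG : ContDiff ℝ 1 fun x => (ψ x : ℂ) * g x :=
    contDiff_mul_of_tsupport_subset (k := 1) hV hg (hψ.of_le (by simp)) hψs
  have hcC : HasCompactSupport fun x => (χ x : ℂ) := hc.comp_left (g := Complex.ofReal) rfl
  have hψcC : HasCompactSupport fun x => (ψ x : ℂ) := hψc.comp_left (g := Complex.ofReal) rfl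
  have hFc : HasCompactSupport fun x => (χ x : ℂ) * f x := hcC.mul_right
  have hGc : HasCompactSupport fun x => (ψ x : ℂ) * g x := hψcC.mul_right
  have h := integral_fderiv_mul_fderiv_comm μ hF hFc hG hGc a b
  have hi : ∀ a b : E, Integrable (fun x => fderiv ℝ (fun x => (χ x : ℂ) * f x) x a *
      fderiv ℝ (fun x => (ψ x : ℂ) * g x) x b) μ := fun a b =>
    ((continuous_fderiv_apply_const hF a).mul
      (continuous_fderiv_apply_const hG b)).integrable_of_hasCompactSupport
        (hGc.fderiv_apply (𝕜 := ℝ) b).mul_left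
  rw [← sub_eq_zero, ← integral_sub (hi a b) (hi b a)] at h
  rw [← h]
  refine integral_congr_ae (Eventually.of_forall fun x => ?_)
  by_cases hx : x ∈ tsupport χ
  · have hfx := (hf.contDiffAt (hV.mem_nhds (hs hx))).differentiableAt one_ne_zero
    have hχx : HasFDerivAt (fun x => (χ x : ℂ)) (Complex.ofRealCLM.comp (fderiv ℝ χ x)) x :=
      Complex.ofRealCLM.hasFDerivAt.comp x (hχ.differentiable (by simp) x).hasFDerivAt
    have hdF : ∀ c, fderiv ℝ (fun x => (χ x : ℂ) * f x) x c
        = χ x * fderiv ℝ f x c + f x * (fderiv ℝ χ x c : ℂ) := fun c => by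
      have := congrArg (· c) (show fderiv ℝ (fun x => (χ x : ℂ) * f x) x = _ from
        (hχx.mul hfx.hasFDerivAt).fderiv)
      simpa using this
    have hev : (fun x => (ψ x : ℂ) * g x) =ᶠ[𝓝 x] g := by
      filter_upwards [hψ1.filter_mono (nhds_le_nhdsSet hx)] with y hy
      simp [hy]
    simp only [hdF, hev.fderiv_eq]
    ring
  · have hχ0 : fderiv ℝ χ x = 0 :=
      image_eq_zero_of_notMem_tsupport fun h => hx (tsupport_fderiv_subset ℝ h)
    have hF0 : fderiv ℝ (fun x => (χ x : ℂ) * f x) x = 0 :=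
      image_eq_zero_of_notMem_tsupport fun h => hx
        (tsupport_mul_subset_left.trans
          (closure_mono fun y hy => by simpa using hy) (tsupport_fderiv_subset ℝ h))
    simp [hχ0, hF0, image_eq_zero_of_notMem_tsupport hx]

/-- `d(∑ᵢ Fᵢ dGᵢ) = ∑ᵢ dFᵢ ∧ dGᵢ` in the weak sense, for functions of class `C¹`. -/
theorem integral_test_mul_formTwo (hV : IsOpen V) (hF : ∀ i, ContDiffOn ℝ 1 (F i) V)
    (hG : ∀ i, ContDiffOn ℝ 1 (G i) V) {χ : E → ℝ} (hχ : ContDiff ℝ ∞ χ)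
    (hc : HasCompactSupport χ) (hs : tsupport χ ⊆ V) (a b : E) :
    ∫ x, ((χ x : ℂ) * formTwo F G x a b + ((fderiv ℝ χ x a : ℂ) * formOne F G x b
      - (fderiv ℝ χ x b : ℂ) * formOne F G x a)) ∂μ = 0 := by
  have hd : ∀ {f : E → ℂ} (c : E), ContDiffOn ℝ 1 f V →
      ContinuousOn (fun x => fderiv ℝ f x c) V :=
    fun c hf => (hf.continuousOn_fderiv_of_isOpen hV le_rfl).clm_apply continuousOn_const
  have hcC : HasCompactSupport fun x => (χ x : ℂ) := hc.comp_left (g := Complex.ofReal) rfl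
  have hsub : ∀ η : E → ℝ, tsupport (fun x => (η x : ℂ)) ⊆ tsupport η :=
    fun _ => closure_mono fun y hy => by simpa using hy
  have hdc : ∀ c, Continuous fun x => (fderiv ℝ χ x c : ℂ) := fun c =>
    Complex.continuous_ofReal.comp ((hχ.continuous_fderiv (by simp)).clm_apply continuous_const)
  have hdcs : ∀ c, HasCompactSupport fun x => (fderiv ℝ χ x c : ℂ) := fun c =>
    (hc.fderiv_apply (𝕜 := ℝ) c).comp_left (g := Complex.ofReal) rfl
  have hds : ∀ c, tsupport (fun x => (fderiv ℝ χ x c : ℂ)) ⊆ V := fun c =>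
    (hsub _).trans ((tsupport_fderiv_apply_subset ℝ c).trans hs)
  have hint : ∀ i, Integrable (fun x => ((χ x : ℂ) * (fderiv ℝ (F i) x a * fderiv ℝ (G i) x b
      - fderiv ℝ (F i) x b * fderiv ℝ (G i) x a))
      + ((fderiv ℝ χ x a : ℂ) * (F i x * fderiv ℝ (G i) x b)
        - (fderiv ℝ χ x b : ℂ) * (F i x * fderiv ℝ (G i) x a))) μ := fun i =>
    (integrable_mul_of_tsupport_subset μ hV (((hd a (hF i)).mul (hd b (hG i))).sub
      ((hd b (hF i)).mul (hd a (hG i)))) (Complex.continuous_ofReal.comp hχ.continuous) hcC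
      ((hsub _).trans hs)).add
    ((integrable_mul_of_tsupport_subset μ hV ((hF i).continuousOn.mul (hd b (hG i))) (hdc a)
      (hdcs a) (hds a)).sub
    (integrable_mul_of_tsupport_subset μ hV ((hF i).continuousOn.mul (hd a (hG i))) (hdc b)
      (hdcs b) (hds b)))
  have hsum := integral_finsetSum (μ := μ) Finset.univ fun i _ => hint i
  simp only [integral_test_mul_wedge μ hV (hF _) (hG _) hχ hc hs a b, Finset.sum_const_zero] at hsum
  rw [← hsum]
  refine integral_congr_ae (Eventually.of_forall fun x => ?_)
  simp only [formTwo, formOne, Finset.mul_sum, mul_sub, Finset.sum_add_distrib,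
    Finset.sum_sub_distrib]

/-- The exterior derivative of `∑ᵢ Fᵢ dGᵢ` depends only on the one-form, although the functions
are merely `C¹`: if the one-form vanishes on an open set, so does `∑ᵢ dFᵢ ∧ dGᵢ`. -/
theorem formTwo_eq_zero_of_formOne_eq_zero (hV : IsOpen V) (hF : ∀ i, ContDiffOn ℝ 1 (F i) V)
    (hG : ∀ i, ContDiffOn ℝ 1 (G i) V) (h : ∀ x ∈ V, ∀ a, formOne F G x a = 0) {x : E}
    (hx : x ∈ V) (a b : E) : formTwo F G x a b = 0 := by
  let μ : Measure E := Measure.addHaar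
  have hcont := continuousOn_formTwo hV hF hG a b
  have hae := hV.ae_eq_zero_of_integral_contDiff_smul_eq_zero (μ := μ)
    (hcont.locallyIntegrableOn hV.measurableSet) fun χ hχ hc hs => by
      rw [← integral_test_mul_formTwo μ hV hF hG hχ hc hs a b]
      refine integral_congr_ae (Eventually.of_forall fun y => ?_)
      by_cases hy : y ∈ tsupport χ
      · simp [h y (hs hy)]
      · have hχ0 : fderiv ℝ χ y = 0 :=
          image_eq_zero_of_notMem_tsupport fun h => hy (tsupport_fderiv_subset ℝ h)
        simp [hχ0]
  exact Measure.eqOn_open_of_ae_eq ((ae_restrict_iff' hV.measurableSet).2 hae) hV hcont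
    continuousOn_const hx

theorem formTwo_eq_of_formOne_eq {ι' : Type*} [Fintype ι'] {F' G' : ι' → E → ℂ} (hV : IsOpen V)
    (hF : ∀ i, ContDiffOn ℝ 1 (F i) V) (hG : ∀ i, ContDiffOn ℝ 1 (G i) V)
    (hF' : ∀ i, ContDiffOn ℝ 1 (F' i) V) (hG' : ∀ i, ContDiffOn ℝ 1 (G' i) V)
    (h : ∀ x ∈ V, ∀ a, formOne F G x a = formOne F' G' x a) {x : E} (hx : x ∈ V) (a b : E) :
    formTwo F G x a b = formTwo F' G' x a b := by
  have := formTwo_eq_zero_of_formOne_eq_zero hV (F := Sum.elim F fun i => -F' i)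
    (G := Sum.elim G G') (by rintro (i | i); exacts [hF i, (hF' i).neg])
    (by rintro (i | i); exacts [hG i, hG' i])
    (fun y hy c => by simpa [formOne, ← sub_eq_add_neg, sub_eq_zero] using h y hy c) hx a b
  simp only [formTwo, Fintype.sum_sum_type, Sum.elim_inl, Sum.elim_inr, fderiv_neg] at this
  rw [← sub_eq_zero, ← this]
  simp only [formTwo, sub_eq_add_neg, ← Finset.sum_neg_distrib]
  congr 1
  refine Finset.sum_congr rfl fun i _ => ?_
  simp
  ring

end WeakCalculus

/-! ### The operators `∂` and `∂̄` -/

section WirtingerDerivatives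

variable {n : ℕ}

/-- The `(1,0)` part `∂f` of the differential at `z`, as a complex linear functional: `dHol f z a` is
the derivative of `f` along `Z_a`. -/
def dHol (f : Cn n → ℂ) (z : Cn n) : Cn n →ₗ[ℂ] ℂ where
  toFun a := (1 / 2 : ℂ) * (fderiv ℝ f z a - Complex.I * fderiv ℝ f z (Complex.I • a))
  map_add' a b := by simp only [smul_add, map_add]; ring
  map_smul' c a := by
    have h : ∀ w : Cn n, fderiv ℝ f z (c • w)
        = c.re * fderiv ℝ f z w + c.im * fderiv ℝ f z (Complex.I • w) := fun w => by
      conv_lhs => rw [← Complex.re_add_im c, add_smul, mul_smul, map_add]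
      simp only [Complex.coe_smul, map_smul, Complex.real_smul]
    rw [smul_comm Complex.I c a, h, h, smul_smul, Complex.I_mul_I, neg_one_smul, map_neg]
    simp only [RingHom.id_apply, smul_eq_mul]
    conv_rhs => rw [← Complex.re_add_im c]
    linear_combination (1 / 2 : ℂ) * c.im * fderiv ℝ f z (Complex.I • a) * Complex.I_sq

/-- The `(0,1)` part `∂̄f` of the differential at `z`, as a conjugate linear function: `dBar f z b` is
the derivative of `f` along the conjugate of `Z_b`. -/
def dBar (f : Cn n → ℂ) (z : Cn n) : Cn n →ₗ⋆[ℂ] ℂ where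
  toFun b := (1 / 2 : ℂ) * (fderiv ℝ f z b + Complex.I * fderiv ℝ f z (Complex.I • b))
  map_add' a b := by simp only [smul_add, map_add]; ring
  map_smul' c a := by
    have h : ∀ w : Cn n, fderiv ℝ f z (c • w)
        = c.re * fderiv ℝ f z w + c.im * fderiv ℝ f z (Complex.I • w) := fun w => by
      conv_lhs => rw [← Complex.re_add_im c, add_smul, mul_smul, map_add]
      simp only [Complex.coe_smul, map_smul, Complex.real_smul]
    rw [smul_comm Complex.I c a, h, h, smul_smul, Complex.I_mul_I, neg_one_smul, map_neg]
    have hc : (starRingEnd ℂ) c = c.re - c.im * Complex.I := by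
      apply Complex.ext <;> simp
    rw [hc, smul_eq_mul]
    linear_combination (1 / 2 : ℂ) * c.im * fderiv ℝ f z (Complex.I • a) * Complex.I_sq

theorem dHol_apply (f : Cn n → ℂ) (z a : Cn n) :
    dHol f z a = (1 / 2 : ℂ) * (fderiv ℝ f z a - Complex.I * fderiv ℝ f z (Complex.I • a)) := rfl

theorem dBar_apply (f : Cn n → ℂ) (z b : Cn n) :
    dBar f z b = (1 / 2 : ℂ) * (fderiv ℝ f z b + Complex.I * fderiv ℝ f z (Complex.I • b)) := rfl

theorem fderiv_eq_dHol_add_dBar (f : Cn n → ℂ) (z a : Cn n) :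
    fderiv ℝ f z a = dHol f z a + dBar f z a := by
  rw [dHol_apply, dBar_apply]; ring

theorem fderiv_half_smul (f : Cn n → ℂ) (z a : Cn n) :
    fderiv ℝ f z ((1 / 2 : ℂ) • a) = 1 / 2 * fderiv ℝ f z a := by
  rw [show (1 / 2 : ℂ) • a = (1 / 2 : ℝ) • a by
    rw [← Complex.coe_smul]; norm_num, map_smul, Complex.real_smul]
  norm_num

theorem cderiv_eq (f : Cn n → ℂ) (z : Cn n) (u : CVec n) :
    cderiv f z u = dHol f z u.hol + dBar f z u.anti := by
  simp only [cderiv, CVec.re, CVec.im, fderiv_half_smul, dHol_apply, dBar_apply, map_add, map_sub,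
    smul_sub]
  ring

theorem cderiv_ofHol (f : Cn n → ℂ) (z a : Cn n) : cderiv f z (CVec.ofHol a) = dHol f z a := by
  simp [cderiv_eq, CVec.ofHol]

theorem cderiv_conj_ofHol (f : Cn n → ℂ) (z b : Cn n) :
    cderiv f z (CVec.ofHol b).conj = dBar f z b := by
  simp [cderiv_eq, CVec.ofHol, CVec.conj]

theorem cderiv_ofReal (f : Cn n → ℂ) (z x : Cn n) :
    cderiv f z (CVec.ofReal x) = fderiv ℝ f z x := by
  rw [cderiv_eq, fderiv_eq_dHol_add_dBar]; rfl

theorem fderiv_star_apply (f : Cn n → ℂ) (z a : Cn n) :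
    fderiv ℝ (fun w => star (f w)) z a = star (fderiv ℝ f z a) := by
  rw [fderiv_star]; rfl

theorem dHol_star (f : Cn n → ℂ) (z a : Cn n) :
    dHol (fun w => star (f w)) z a = star (dBar f z a) := by
  simp only [dHol_apply, dBar_apply, fderiv_star_apply]
  simp
  ring

theorem dBar_star (f : Cn n → ℂ) (z a : Cn n) :
    dBar (fun w => star (f w)) z a = star (dHol f z a) := by
  simp only [dHol_apply, dBar_apply, fderiv_star_apply]
  simp

theorem fderiv_star_coord (m : Fin n) (z x : Cn n) :
    fderiv ℝ (fun w : Cn n => star (w m)) z x = star (x m) := by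
  rw [fderiv_star_apply]
  congr 1
  exact congrArg (· x) (ContinuousLinearMap.proj (R := ℝ) m : Cn n →L[ℝ] ℂ).fderiv

theorem dHol_star_coord (m : Fin n) (z c : Cn n) :
    dHol (fun w : Cn n => star (w m)) z c = 0 := by
  rw [dHol_apply, fderiv_star_coord, fderiv_star_coord, Pi.smul_apply, smul_eq_mul, star_mul',
    Complex.star_def, Complex.conj_I]
  linear_combination (1 / 2 : ℂ) * (starRingEnd ℂ) (c m) * Complex.I_sq

theorem dBar_star_coord (m : Fin n) (z c : Cn n) :
    dBar (fun w : Cn n => star (w m)) z c = star (c m) := by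
  rw [dBar_apply, fderiv_star_coord, fderiv_star_coord, Pi.smul_apply, smul_eq_mul, star_mul',
    Complex.star_def, Complex.conj_I]
  linear_combination -(1 / 2 : ℂ) * (starRingEnd ℂ) (c m) * Complex.I_sq

theorem differentiableAt_star {f : Cn n → ℂ} {z : Cn n} (h : DifferentiableAt ℝ f z) :
    DifferentiableAt ℝ (fun w => star (f w)) z :=
  (starL' ℝ : ℂ ≃L[ℝ] ℂ).differentiableAt.comp z h

theorem dHol_eq_sum (f : Cn n → ℂ) (z a : Cn n) :
    dHol f z a = ∑ j, a j * dHol f z (Pi.single j 1) := by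
  conv_lhs => rw [← Finset.univ_sum_single a, map_sum]
  refine Finset.sum_congr rfl fun j _ => ?_
  rw [← smul_eq_mul, ← map_smul, ← Pi.single_smul', smul_eq_mul, mul_one]

theorem dBar_eq_sum (f : Cn n → ℂ) (z b : Cn n) :
    dBar f z b = ∑ j, star (b j) * dBar f z (Pi.single j 1) := by
  conv_lhs => rw [← Finset.univ_sum_single b, map_sum]
  refine Finset.sum_congr rfl fun j _ => ?_
  rw [show star (b j) = (starRingEnd ℂ) (b j) from rfl, ← smul_eq_mul, ← map_smulₛₗ,
    ← Pi.single_smul', smul_eq_mul, mul_one]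

end WirtingerDerivatives

/-! ### The complex Hessian -/

section SecondDerivatives

variable {n : ℕ} {ρ : Cn n → ℝ} {z : Cn n}

theorem delCoeff_eq (ρ : Cn n → ℝ) (z : Cn n) (j : Fin n) :
    delCoeff ρ z j = dHol (toC ρ) z (Pi.single j 1) := cderiv_ofHol _ _ _

theorem star_toC (ρ : Cn n → ℝ) : (fun w => star (toC ρ w)) = toC ρ := by
  funext w; simp [toC]

theorem dBar_toC (ρ : Cn n → ℝ) (z b : Cn n) : dBar (toC ρ) z b = star (dHol (toC ρ) z b) := by
  rw [← dBar_star, star_toC]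

theorem dHol_toC_eq_sum (ρ : Cn n → ℝ) (z a : Cn n) :
    dHol (toC ρ) z a = ∑ j, a j * delCoeff ρ z j := by
  simp only [dHol_eq_sum (toC ρ) z a, delCoeff_eq]

theorem dBar_toC_eq_sum (ρ : Cn n → ℝ) (z b : Cn n) :
    dBar (toC ρ) z b = ∑ j, star (b j) * star (delCoeff ρ z j) := by
  simp only [dBar_toC, dHol_toC_eq_sum, star_sum, star_mul']

theorem mem_holTangent {a : Cn n} : a ∈ holTangent ρ z ↔ dHol (toC ρ) z a = 0 := by
  simp [holTangent, cderiv_ofHol]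

theorem deldelbar_eq (f : Cn n → ℂ) (z a b : Cn n) :
    deldelbar f z a b = dHol (fun w => dBar f w b) z a := by
  simp only [deldelbar, cderiv_ofHol, cderiv_conj_ofHol]

theorem contDiffAt_toC {k : WithTop ℕ∞} (h : ContDiffAt ℝ k ρ z) : ContDiffAt ℝ k (toC ρ) z :=
  Complex.ofRealCLM.contDiff.contDiffAt.comp z h

theorem fderiv_toC {χ : Cn n → ℝ} (hχ : DifferentiableAt ℝ χ z) (a : Cn n) :
    fderiv ℝ (toC χ) z a = (fderiv ℝ χ z a : ℂ) :=
  congrArg (· a) (Complex.ofRealCLM.hasFDerivAt.comp z hχ.hasFDerivAt).fderiv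

theorem contDiffAt_dHol {f : Cn n → ℂ} (h : ContDiffAt ℝ 2 f z) (a : Cn n) :
    ContDiffAt ℝ 1 (fun w => dHol f w a) z := by
  have h1 : ContDiffAt ℝ 1 (fderiv ℝ f) z := h.fderiv_right (by norm_num)
  have h2 : ∀ c, ContDiffAt ℝ 1 (fun w => fderiv ℝ f w c) z := fun c =>
    h1.clm_apply contDiffAt_const
  exact contDiffAt_const.mul ((h2 a).sub (contDiffAt_const.mul (h2 _)))

theorem contDiffAt_dBar {f : Cn n → ℂ} (h : ContDiffAt ℝ 2 f z) (a : Cn n) :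
    ContDiffAt ℝ 1 (fun w => dBar f w a) z := by
  have h1 : ContDiffAt ℝ 1 (fderiv ℝ f) z := h.fderiv_right (by norm_num)
  have h2 : ∀ c, ContDiffAt ℝ 1 (fun w => fderiv ℝ f w c) z := fun c =>
    h1.clm_apply contDiffAt_const
  exact contDiffAt_const.mul ((h2 a).add (contDiffAt_const.mul (h2 _)))

theorem contDiffAt_delCoeff (h : ContDiffAt ℝ 2 ρ z) (j : Fin n) :
    ContDiffAt ℝ 1 (fun w => delCoeff ρ w j) z := by
  simp only [delCoeff_eq]
  exact contDiffAt_dHol (contDiffAt_toC h) _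

theorem contDiffAt_star {k : WithTop ℕ∞} {f : Cn n → ℂ} (h : ContDiffAt ℝ k f z) :
    ContDiffAt ℝ k (fun w => star (f w)) z :=
  (starL' ℝ : ℂ ≃L[ℝ] ℂ).contDiff.contDiffAt.comp z h

theorem fderiv_fderiv_comm {f : Cn n → ℂ} (h : ContDiffAt ℝ 2 f z) (x y : Cn n) :
    fderiv ℝ (fun w => fderiv ℝ f w y) z x = fderiv ℝ (fun w => fderiv ℝ f w x) z y := by
  have h1 : DifferentiableAt ℝ (fderiv ℝ f) z :=
    (h.fderiv_right (m := 1) (by norm_num)).differentiableAt one_ne_zero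
  have h2 : ∀ x y, fderiv ℝ (fun w => fderiv ℝ f w y) z x = fderiv ℝ (fderiv ℝ f) z x y :=
    fun x y => by rw [fderiv_clm_apply h1 (differentiableAt_const y)]; simp
  rw [h2, h2]
  exact (h.isSymmSndFDerivAt (by simp)).eq x y

theorem fderiv_dHol {f : Cn n → ℂ} (h : ContDiffAt ℝ 2 f z) (a x : Cn n) :
    fderiv ℝ (fun w => dHol f w a) z x = (1 / 2 : ℂ) * (fderiv ℝ (fun w => fderiv ℝ f w a) z x
      - Complex.I * fderiv ℝ (fun w => fderiv ℝ f w (Complex.I • a)) z x) := by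
  have h1 : ContDiffAt ℝ 1 (fderiv ℝ f) z := h.fderiv_right (by norm_num)
  have h2 : ∀ c, DifferentiableAt ℝ (fun w => fderiv ℝ f w c) z := fun c =>
    (h1.clm_apply contDiffAt_const).differentiableAt one_ne_zero
  simp only [dHol_apply]
  rw [fderiv_const_mul ((h2 _).fun_sub ((h2 _).const_mul _)), fderiv_fun_sub (h2 _) ((h2 _).const_mul _),
    fderiv_const_mul (h2 _)]
  rfl

theorem fderiv_dBar {f : Cn n → ℂ} (h : ContDiffAt ℝ 2 f z) (a x : Cn n) :
    fderiv ℝ (fun w => dBar f w a) z x = (1 / 2 : ℂ) * (fderiv ℝ (fun w => fderiv ℝ f w a) z x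
      + Complex.I * fderiv ℝ (fun w => fderiv ℝ f w (Complex.I • a)) z x) := by
  have h1 : ContDiffAt ℝ 1 (fderiv ℝ f) z := h.fderiv_right (by norm_num)
  have h2 : ∀ c, DifferentiableAt ℝ (fun w => fderiv ℝ f w c) z := fun c =>
    (h1.clm_apply contDiffAt_const).differentiableAt one_ne_zero
  simp only [dBar_apply]
  rw [fderiv_const_mul ((h2 _).fun_add ((h2 _).const_mul _)), fderiv_fun_add (h2 _) ((h2 _).const_mul _),
    fderiv_const_mul (h2 _)]
  rfl

theorem dHol_dBar_comm {f : Cn n → ℂ} (h : ContDiffAt ℝ 2 f z) (a b : Cn n) :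
    dHol (fun w => dBar f w b) z a = dBar (fun w => dHol f w a) z b := by
  rw [dHol_apply, dBar_apply, fderiv_dBar h, fderiv_dBar h, fderiv_dHol h, fderiv_dHol h]
  rw [fderiv_fderiv_comm h a b, fderiv_fderiv_comm h a (Complex.I • b),
    fderiv_fderiv_comm h (Complex.I • a) b, fderiv_fderiv_comm h (Complex.I • a) (Complex.I • b)]
  ring

theorem dHol_dHol_comm {f : Cn n → ℂ} (h : ContDiffAt ℝ 2 f z) (a b : Cn n) :
    dHol (fun w => dHol f w b) z a = dHol (fun w => dHol f w a) z b := by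
  rw [dHol_apply, dHol_apply, fderiv_dHol h, fderiv_dHol h, fderiv_dHol h, fderiv_dHol h]
  rw [fderiv_fderiv_comm h a b, fderiv_fderiv_comm h a (Complex.I • b),
    fderiv_fderiv_comm h (Complex.I • a) b, fderiv_fderiv_comm h (Complex.I • a) (Complex.I • b)]
  ring

theorem dBar_dBar_comm {f : Cn n → ℂ} (h : ContDiffAt ℝ 2 f z) (a b : Cn n) :
    dBar (fun w => dBar f w b) z a = dBar (fun w => dBar f w a) z b := by
  rw [dBar_apply, dBar_apply, fderiv_dBar h, fderiv_dBar h, fderiv_dBar h, fderiv_dBar h]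
  rw [fderiv_fderiv_comm h a b, fderiv_fderiv_comm h a (Complex.I • b),
    fderiv_fderiv_comm h (Complex.I • a) b, fderiv_fderiv_comm h (Complex.I • a) (Complex.I • b)]
  ring

theorem deldelbar_conj (h : ContDiffAt ℝ 2 ρ z) (a b : Cn n) :
    deldelbar (toC ρ) z b a = star (deldelbar (toC ρ) z a b) := by
  rw [deldelbar_eq, deldelbar_eq, dHol_dBar_comm (contDiffAt_toC h), ← dBar_star]
  simp only [dBar_toC, star_star]

theorem dHol_star_delCoeff (ρ : Cn n → ℝ) (z a : Cn n) (j : Fin n) :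
    dHol (fun w => star (delCoeff ρ w j)) z a = deldelbar (toC ρ) z a (Pi.single j 1) := by
  simp only [deldelbar_eq, delCoeff_eq, dBar_toC]

theorem fderiv_dBar_toC (h : ContDiffAt ℝ 2 ρ z) (b x : Cn n) :
    fderiv ℝ (fun w => dBar (toC ρ) w b) z x
      = ∑ j, star (b j) * fderiv ℝ (fun w => star (delCoeff ρ w j)) z x := by
  have hd : ∀ j, DifferentiableAt ℝ (fun w => star (delCoeff ρ w j)) z := fun j =>
    (contDiffAt_star (contDiffAt_delCoeff h j)).differentiableAt one_ne_zero
  simp only [dBar_toC_eq_sum]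
  rw [fderiv_fun_sum fun j _ => (hd j).const_mul _]
  simp only [sum_apply]
  refine Finset.sum_congr rfl fun j _ => ?_
  rw [fderiv_const_mul (hd j)]; rfl

theorem dHol_dBar_toC (h : ContDiffAt ℝ 2 ρ z) (b a : Cn n) :
    dHol (fun w => dBar (toC ρ) w b) z a
      = ∑ j, star (b j) * dHol (fun w => star (delCoeff ρ w j)) z a := by
  simp only [dHol_apply, fderiv_dBar_toC h, Finset.mul_sum, ← Finset.sum_sub_distrib]
  exact Finset.sum_congr rfl fun j _ => by ring

theorem dBar_dBar_toC (h : ContDiffAt ℝ 2 ρ z) (b a : Cn n) :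
    dBar (fun w => dBar (toC ρ) w b) z a
      = ∑ j, star (b j) * dBar (fun w => star (delCoeff ρ w j)) z a := by
  rw [dBar_apply, fderiv_dBar_toC h, fderiv_dBar_toC h]
  simp only [dBar_apply, Finset.mul_sum, ← Finset.sum_add_distrib]
  exact Finset.sum_congr rfl fun j _ => by ring

theorem deldelbar_add_left (f : Cn n → ℂ) (z a a' b : Cn n) :
    deldelbar f z (a + a') b = deldelbar f z a b + deldelbar f z a' b := by
  simp only [deldelbar_eq, map_add]

theorem deldelbar_smul_left (f : Cn n → ℂ) (z : Cn n) (c : ℂ) (a b : Cn n) :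
    deldelbar f z (c • a) b = c * deldelbar f z a b := by
  simp only [deldelbar_eq, map_smul, smul_eq_mul]

theorem deldelbar_add_right (h : ContDiffAt ℝ 2 ρ z) (a b b' : Cn n) :
    deldelbar (toC ρ) z a (b + b') = deldelbar (toC ρ) z a b + deldelbar (toC ρ) z a b' := by
  rw [deldelbar_conj h (b + b') a, deldelbar_add_left, star_add, ← deldelbar_conj h,
    ← deldelbar_conj h]

theorem deldelbar_smul_right (h : ContDiffAt ℝ 2 ρ z) (c : ℂ) (a b : Cn n) :
    deldelbar (toC ρ) z a (c • b) = star c * deldelbar (toC ρ) z a b := by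
  rw [deldelbar_conj h (c • b) a, deldelbar_smul_left, star_mul', ← deldelbar_conj h]

end SecondDerivatives

/-! ### The form `β` in a chart -/

section LocalTheory

variable {n : ℕ} {ρ : Cn n → ℝ} {L : Cn n → Cn n} {V : Set (Cn n)} {z : Cn n}

/-- The derivative of `∂ρ/∂z_m` along the real vector field with coordinates `L`. -/
def normalDerivDel (ρ : Cn n → ℝ) (L : Cn n → Cn n) (m : Fin n) (z : Cn n) : ℂ :=
  fderiv ℝ (fun w => delCoeff ρ w m) z (L z)

theorem star_normalDerivDel (ρ : Cn n → ℝ) (L : Cn n → Cn n) (m : Fin n) (z : Cn n) :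
    star (normalDerivDel ρ L m z) = fderiv ℝ (fun w => star (delCoeff ρ w m)) z (L z) := by
  rw [fderiv_star_apply]; rfl

/-- What the metric contributes to the local theory: a `C¹` vector field `L` with `∂ρ(Z_L) = 1` along
which the first derivatives of `ρ` have derivatives of class `C¹`, although `ρ` is only `C²`. -/
structure IsTransverse (ρ : Cn n → ℝ) (L : Cn n → Cn n) (V : Set (Cn n)) : Prop where
  isOpen : IsOpen V
  contDiffOn : ContDiffOn ℝ 2 ρ V
  contDiffOn_field : ContDiffOn ℝ 1 L V
  contDiffOn_normalDerivDel : ∀ m, ContDiffOn ℝ 1 (normalDerivDel ρ L m) V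
  sum_mul_delCoeff : ∀ z ∈ V, ∑ j, L z j * delCoeff ρ z j = 1

/-- The continuous one-form `α' - α''` on real tangent vectors, where `α'` and `α''` are the `(1,0)`
and `(0,1)` parts of `α`. -/
def alphaDiff (ρ : Cn n → ℝ) (L : Cn n → Cn n) (z x : Cn n) : ℂ :=
  deldelbar (toC ρ) z x (L z) - deldelbar (toC ρ) z (L z) x

/-- The functions `Fᵢ` in the representation `α' - α'' = ∑ᵢ Fᵢ dGᵢ`. -/
def potentialLeft (ρ : Cn n → ℝ) (L : Cn n → Cn n) : Fin n ⊕ Fin n → Cn n → ℂ :=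
  Sum.elim (fun j w => star (L w j)) fun m w => -star (normalDerivDel ρ L m w)

/-- The functions `Gᵢ` in the representation `α' - α'' = ∑ᵢ Fᵢ dGᵢ`. -/
def potentialRight (ρ : Cn n → ℝ) : Fin n ⊕ Fin n → Cn n → ℂ :=
  Sum.elim (fun j w => star (delCoeff ρ w j)) fun m w => star (w m)

/-- The exterior derivative of `α' - α''`. -/
def dAlphaDiff (ρ : Cn n → ℝ) (L : Cn n → Cn n) (z x y : Cn n) : ℂ :=
  formTwo (potentialLeft ρ L) (potentialRight ρ) z x y

/-- The two-form `β = -(i/2)(∂α - ∂̄α)` on real tangent vectors. For the complex structure `J` one has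
`(∂α - ∂̄α)(u, v) = -d(α' - α'')(Ju, Jv)`. -/
def betaLocal (ρ : Cn n → ℝ) (L : Cn n → Cn n) (z x y : Cn n) : ℝ :=
  (Complex.I / 2 * dAlphaDiff ρ L z (Complex.I • x) (Complex.I • y)).re

namespace IsTransverse

theorem contDiffAt (h : IsTransverse ρ L V) (hz : z ∈ V) : ContDiffAt ℝ 2 ρ z :=
  h.contDiffOn.contDiffAt (h.isOpen.mem_nhds hz)

theorem contDiffOn_potentialLeft (h : IsTransverse ρ L V) (i : Fin n ⊕ Fin n) :
    ContDiffOn ℝ 1 (potentialLeft ρ L i) V := by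
  intro z hz
  refine ContDiffAt.contDiffWithinAt ?_
  have hn := h.isOpen.mem_nhds hz
  rcases i with j | m
  · exact contDiffAt_star (contDiffAt_pi.1 (h.contDiffOn_field.contDiffAt hn) j)
  · exact (contDiffAt_star ((h.contDiffOn_normalDerivDel m).contDiffAt hn)).neg

theorem contDiffOn_potentialRight (h : IsTransverse ρ L V) (i : Fin n ⊕ Fin n) :
    ContDiffOn ℝ 1 (potentialRight ρ i) V := by
  intro z hz
  refine ContDiffAt.contDiffWithinAt ?_
  rcases i with j | m
  · exact contDiffAt_star (contDiffAt_delCoeff (h.contDiffAt hz) j)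
  · exact contDiffAt_star (contDiffAt_pi.1 contDiffAt_id m)

/-- `α' - α'' = ∑ⱼ conj(Lⱼ) d(∂ρ/∂z̄ⱼ) - ∑ₘ L(∂ρ/∂z̄ₘ) dz̄ₘ`: on `(0,1)` vectors the two sums combine to
`-α''` because second derivatives commute. -/
theorem formOne_potential (h : IsTransverse ρ L V) (hz : z ∈ V) (x : Cn n) :
    formOne (potentialLeft ρ L) (potentialRight ρ) z x = alphaDiff ρ L z x := by
  have hρ := h.contDiffAt hz
  simp only [formOne, potentialLeft, potentialRight, Fintype.sum_sum_type, Sum.elim_inl,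
    Sum.elim_inr, fderiv_star_coord, star_normalDerivDel]
  have h1 := fderiv_dBar_toC hρ (L z) x
  have h2 := fderiv_dBar_toC hρ x (L z)
  have h3 : ∑ m, -fderiv ℝ (fun w => star (delCoeff ρ w m)) z (L z) * star (x m)
      = -fderiv ℝ (fun w => dBar (toC ρ) w x) z (L z) := by
    rw [h2, ← Finset.sum_neg_distrib]
    exact Finset.sum_congr rfl fun m _ => by ring
  rw [h3, ← h1, fderiv_eq_dHol_add_dBar, fderiv_eq_dHol_add_dBar (fun w => dBar (toC ρ) w x),
    dBar_dBar_comm (contDiffAt_toC hρ) x, alphaDiff, deldelbar_eq, deldelbar_eq]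
  ring

theorem star_alphaDiff (h : IsTransverse ρ L V) (hz : z ∈ V) (x : Cn n) :
    star (alphaDiff ρ L z x) = -alphaDiff ρ L z x := by
  rw [alphaDiff, star_sub, ← deldelbar_conj (h.contDiffAt hz), ← deldelbar_conj (h.contDiffAt hz)]
  ring

theorem star_dAlphaDiff (h : IsTransverse ρ L V) (hz : z ∈ V) (x y : Cn n) :
    star (dAlphaDiff ρ L z x y) = -dAlphaDiff ρ L z x y := by
  have key := formTwo_eq_of_formOne_eq h.isOpen
    (F := fun i w => star (potentialLeft ρ L i w)) (G := fun i w => star (potentialRight ρ i w))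
    (F' := fun i w => -potentialLeft ρ L i w) (G' := potentialRight ρ)
    (fun i w hw => (contDiffAt_star ((h.contDiffOn_potentialLeft i).contDiffAt
      (h.isOpen.mem_nhds hw))).contDiffWithinAt)
    (fun i w hw => (contDiffAt_star ((h.contDiffOn_potentialRight i).contDiffAt
      (h.isOpen.mem_nhds hw))).contDiffWithinAt)
    (fun i => (h.contDiffOn_potentialLeft i).neg) h.contDiffOn_potentialRight
    (fun w hw a => by
      have h1 := h.star_alphaDiff hw a
      rw [← h.formOne_potential hw] at h1
      simpa only [formOne, fderiv_star_apply, star_sum, star_mul', neg_mul,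
        Finset.sum_neg_distrib] using h1) hz x y
  simp only [dAlphaDiff, formTwo, fderiv_star_apply, fderiv_fun_neg, neg_apply, star_sum, star_sub,
    star_mul', ← Finset.sum_neg_distrib] at key ⊢
  rw [key]
  exact Finset.sum_congr rfl fun i _ => by ring

theorem coe_betaLocal (h : IsTransverse ρ L V) (hz : z ∈ V) (x y : Cn n) :
    (betaLocal ρ L z x y : ℂ)
      = Complex.I / 2 * dAlphaDiff ρ L z (Complex.I • x) (Complex.I • y) := by
  rw [betaLocal]
  refine (Complex.conj_eq_iff_re.1 ?_)
  have := h.star_dAlphaDiff hz (Complex.I • x) (Complex.I • y)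
  rw [Complex.star_def] at this
  rw [map_mul, this, map_div₀, Complex.conj_I, map_ofNat]
  ring

theorem continuousOn_betaLocal (h : IsTransverse ρ L V) (x y : Cn n) :
    ContinuousOn (fun z => betaLocal ρ L z x y) V :=
  Complex.continuous_re.comp_continuousOn (continuousOn_const.mul
    (continuousOn_formTwo h.isOpen h.contDiffOn_potentialLeft h.contDiffOn_potentialRight _ _))

theorem complexify_betaLocal (h : IsTransverse ρ L V) (hz : z ∈ V) (u v : CVec n) :
    complexify (betaLocal ρ L z) u v = Complex.I / 2 *
      (dAlphaDiff ρ L z (Complex.I • u.re) (Complex.I • v.re)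
        - dAlphaDiff ρ L z (Complex.I • u.im) (Complex.I • v.im)
        + Complex.I * (dAlphaDiff ρ L z (Complex.I • u.re) (Complex.I • v.im)
          + dAlphaDiff ρ L z (Complex.I • u.im) (Complex.I • v.re))) := by
  simp only [complexify, Complex.ofReal_sub, Complex.ofReal_add, h.coe_betaLocal hz]
  ring

end IsTransverse

theorem fderiv_I_smul_re (f : Cn n → ℂ) (z : Cn n) (u : CVec n) :
    fderiv ℝ f z (Complex.I • u.re) + Complex.I * fderiv ℝ f z (Complex.I • u.im)
      = Complex.I * (dHol f z u.hol - dBar f z u.anti) := by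
  simp only [fderiv_eq_dHol_add_dBar, CVec.re, CVec.im, map_smul, map_smulₛₗ, map_add, map_sub,
    smul_eq_mul, Complex.conj_I, map_div₀, map_one, map_ofNat]
  linear_combination ((1 / 2 : ℂ) * Complex.I * (dHol f z u.anti - dHol f z u.hol
    + dBar f z u.anti - dBar f z u.hol)) * Complex.I_sq

namespace IsTransverse

theorem complexify_betaLocal_eq_sum (h : IsTransverse ρ L V) (hz : z ∈ V) (u v : CVec n) :
    complexify (betaLocal ρ L z) u v = -(Complex.I / 2) * ∑ i,
      ((dHol (potentialLeft ρ L i) z u.hol - dBar (potentialLeft ρ L i) z u.anti)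
        * (dHol (potentialRight ρ i) z v.hol - dBar (potentialRight ρ i) z v.anti)
      - (dHol (potentialLeft ρ L i) z v.hol - dBar (potentialLeft ρ L i) z v.anti)
        * (dHol (potentialRight ρ i) z u.hol - dBar (potentialRight ρ i) z u.anti)) := by
  rw [h.complexify_betaLocal hz, neg_mul, ← mul_neg, ← Finset.sum_neg_distrib]
  congr 1
  simp only [dAlphaDiff, formTwo, Finset.mul_sum, ← Finset.sum_sub_distrib,
    ← Finset.sum_add_distrib]
  refine Finset.sum_congr rfl fun i _ => ?_
  have e : ∀ f : Cn n → ℂ, ∀ u : CVec n, dHol f z u.hol - dBar f z u.anti = -Complex.I *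
      (fderiv ℝ f z (Complex.I • u.re) + Complex.I * fderiv ℝ f z (Complex.I • u.im)) :=
    fun f u => by
      rw [fderiv_I_smul_re]
      linear_combination (dHol f z u.hol - dBar f z u.anti) * Complex.I_sq
  simp only [e]
  generalize fderiv ℝ (potentialLeft ρ L i) z = P
  generalize fderiv ℝ (potentialRight ρ i) z = Q
  ring_nf
  simp only [Complex.I_sq, show Complex.I ^ 3 = -Complex.I by rw [pow_succ, Complex.I_sq]; ring,
    Complex.I_pow_four]
  ring

theorem alpha_eq (h : IsTransverse ρ L V) (hz : z ∈ V) (u : CVec n) :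
    deldelbar (toC ρ) z u.hol (L z) + deldelbar (toC ρ) z (L z) u.anti
      = -Complex.I * (alphaDiff ρ L z (Complex.I • u.re)
        + Complex.I * alphaDiff ρ L z (Complex.I • u.im)) := by
  have hρ := h.contDiffAt hz
  have hm : ∀ a b : Cn n, a - b = a + (-1 : ℂ) • b := fun a b => by simp [sub_eq_add_neg]
  simp only [alphaDiff, CVec.re, CVec.im, hm, deldelbar_smul_left, deldelbar_smul_right hρ,
    deldelbar_add_left, deldelbar_add_right hρ]
  simp only [Complex.star_def, Complex.conj_I, map_div₀, map_one, map_ofNat, map_neg]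
  ring_nf
  simp only [Complex.I_sq, Complex.I_pow_four]
  ring

theorem continuousOn_alphaDiff (h : IsTransverse ρ L V) (x : Cn n) :
    ContinuousOn (fun z => alphaDiff ρ L z x) V :=
  (continuousOn_formOne h.isOpen h.contDiffOn_potentialLeft h.contDiffOn_potentialRight x).congr
    fun _ hz => (h.formOne_potential hz x).symm

theorem continuousOn_dAlphaDiff (h : IsTransverse ρ L V) (x y : Cn n) :
    ContinuousOn (fun z => dAlphaDiff ρ L z x y) V :=
  continuousOn_formTwo h.isOpen h.contDiffOn_potentialLeft h.contDiffOn_potentialRight x y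

theorem weakBetaEq (h : IsTransverse ρ L V) :
    WeakBetaEq V (fun z u => deldelbar (toC ρ) z u.hol (L z) + deldelbar (toC ρ) z (L z) u.anti)
      (betaLocal ρ L) := by
  intro χ hχ hc hs u v
  set α : Cn n → CVec n → ℂ :=
    fun z u => deldelbar (toC ρ) z u.hol (L z) + deldelbar (toC ρ) z (L z) u.anti with hα
  have hχd : ∀ z, DifferentiableAt ℝ χ z := fun z => hχ.differentiable (by simp) z
  have hχC : ContDiff ℝ ∞ (toC χ) := Complex.ofRealCLM.contDiff.comp hχ
  have hcC : HasCompactSupport (toC χ) := hc.comp_left (g := Complex.ofReal) rfl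
  have hsub : tsupport (toC χ) ⊆ tsupport χ := closure_mono fun y hy => by simpa [toC] using hy
  have hdc : ∀ w : CVec n, Continuous fun z => cderiv (toC χ) z w := fun w => by
    have hd : ∀ a, Continuous fun z => fderiv ℝ (toC χ) z a := fun a =>
      (hχC.continuous_fderiv (by simp)).clm_apply continuous_const
    exact (hd _).add (continuous_const.mul (hd _))
  have hsupp : ∀ w : CVec n, Function.support (fun z => cderiv (toC χ) z w)
      ⊆ tsupport (toC χ) := fun w z hz => by
    by_contra hn
    have h0 : fderiv ℝ (toC χ) z = 0 :=
      image_eq_zero_of_notMem_tsupport fun h => hn (tsupport_fderiv_subset ℝ h)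
    exact hz (by simp [cderiv, h0])
  have hdt : ∀ w : CVec n, tsupport (fun z => cderiv (toC χ) z w) ⊆ tsupport (toC χ) := fun w =>
    closure_minimal (hsupp w) (isClosed_tsupport _)
  have hαc : ∀ w, ContinuousOn (fun z => α z w) V := fun w =>
    (continuousOn_const.mul ((h.continuousOn_alphaDiff _).add
      (continuousOn_const.mul (h.continuousOn_alphaDiff _)))).congr fun z hz => h.alpha_eq hz w
  have hint : ∀ w w' : CVec n, Integrable fun z => cderiv (toC χ) z w * α z w' := fun w w' =>
    integrable_mul_of_tsupport_subset volume h.isOpen (hαc w') (hdc w)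
      (hcC.of_isClosed_subset (isClosed_tsupport _) (hdt w)) (((hdt w).trans hsub).trans hs)
  have hintχ : ∀ {f : Cn n → ℂ}, ContinuousOn f V → Integrable fun z => (χ z : ℂ) * f z :=
    fun hf => integrable_mul_of_tsupport_subset volume h.isOpen hf hχC.continuous hcC
      (hsub.trans hs)
  have hΦint : ∀ x y : Cn n, Integrable fun z => (χ z : ℂ) * dAlphaDiff ρ L z x y
      + ((fderiv ℝ χ z x : ℂ) * alphaDiff ρ L z y - (fderiv ℝ χ z y : ℂ) * alphaDiff ρ L z x) := by
    intro x y
    have hone : ∀ x y, Integrable fun z => (fderiv ℝ χ z x : ℂ) * alphaDiff ρ L z y :=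
      fun x y => by
        have := integrable_mul_of_tsupport_subset volume h.isOpen (h.continuousOn_alphaDiff y)
          (hdc (CVec.ofReal x)) (hcC.of_isClosed_subset (isClosed_tsupport _) (hdt _))
          (((hdt _).trans hsub).trans hs)
        simpa only [cderiv_ofReal, fderiv_toC (hχd _)] using this
    exact (hintχ (h.continuousOn_dAlphaDiff x y)).add ((hone x y).sub (hone y x))
  have hΦ : ∀ x y : Cn n, ∫ z, ((χ z : ℂ) * dAlphaDiff ρ L z x y
      + ((fderiv ℝ χ z x : ℂ) * alphaDiff ρ L z y
        - (fderiv ℝ χ z y : ℂ) * alphaDiff ρ L z x)) = 0 := by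
    intro x y
    rw [← integral_test_mul_formTwo volume h.isOpen h.contDiffOn_potentialLeft
      h.contDiffOn_potentialRight hχ hc hs x y]
    refine integral_congr_ae (Eventually.of_forall fun z => ?_)
    by_cases hz : z ∈ tsupport χ
    · simp only [h.formOne_potential (hs hz), dAlphaDiff]
    · have hχ0 : fderiv ℝ χ z = 0 :=
        image_eq_zero_of_notMem_tsupport fun h => hz (tsupport_fderiv_subset ℝ h)
      simp [hχ0, image_eq_zero_of_notMem_tsupport hz]
  set Φ : Cn n → Cn n → Cn n → ℂ := fun x y z => (χ z : ℂ) * dAlphaDiff ρ L z x y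
      + ((fderiv ℝ χ z x : ℂ) * alphaDiff ρ L z y
        - (fderiv ℝ χ z y : ℂ) * alphaDiff ρ L z x) with hΦdef
  have e1 : Integrable (fun z => Complex.I / 2 * (Φ (Complex.I • u.re) (Complex.I • v.re) z
      - Φ (Complex.I • u.im) (Complex.I • v.im) z
      + Complex.I * (Φ (Complex.I • u.re) (Complex.I • v.im) z
        + Φ (Complex.I • u.im) (Complex.I • v.re) z))) :=
    (((hΦint _ _).sub (hΦint _ _)).add (((hΦint _ _).add (hΦint _ _)).const_mul _)).const_mul _
  have e2 : ∫ z, Complex.I / 2 * (Φ (Complex.I • u.re) (Complex.I • v.re) z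
      - Φ (Complex.I • u.im) (Complex.I • v.im) z
      + Complex.I * (Φ (Complex.I • u.re) (Complex.I • v.im) z
        + Φ (Complex.I • u.im) (Complex.I • v.re) z)) = 0 := by
    have hsub : ∀ x y x' y', Integrable fun z => Φ x y z - Φ x' y' z :=
      fun _ _ _ _ => (hΦint _ _).sub (hΦint _ _)
    have hadd : ∀ x y x' y', Integrable fun z => Complex.I * (Φ x y z + Φ x' y' z) :=
      fun _ _ _ _ => ((hΦint _ _).add (hΦint _ _)).const_mul _
    rw [integral_const_mul, integral_add (hsub _ _ _ _) (hadd _ _ _ _),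
      integral_sub (hΦint _ _) (hΦint _ _), integral_const_mul,
      integral_add (hΦint _ _) (hΦint _ _)]
    simp only [hΦ]
    simp
  have hintsub : ∀ w w' v v' : CVec n, Integrable fun z =>
      cderiv (toC χ) z w * α z w' - cderiv (toC χ) z v * α z v' :=
    fun _ _ _ _ => (hint _ _).sub (hint _ _)
  rw [delWeak, delbarWeak, neg_sub_neg, ← integral_sub (hintsub _ _ _ _) (hintsub _ _ _ _),
    ← integral_const_mul, ← sub_eq_zero]
  have hR : Integrable fun z => -(Complex.I / 2) *
      (cderiv (toC χ) z u.antiPart * α z v - cderiv (toC χ) z v.antiPart * α z u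
        - (cderiv (toC χ) z u.holPart * α z v - cderiv (toC χ) z v.holPart * α z u)) :=
    ((hintsub _ _ _ _).sub (hintsub _ _ _ _)).const_mul _
  have hpt : ∀ z, Complex.I / 2 * (Φ (Complex.I • u.re) (Complex.I • v.re) z
      - Φ (Complex.I • u.im) (Complex.I • v.im) z
      + Complex.I * (Φ (Complex.I • u.re) (Complex.I • v.im) z
        + Φ (Complex.I • u.im) (Complex.I • v.re) z)) + (-(Complex.I / 2) *
      (cderiv (toC χ) z u.antiPart * α z v - cderiv (toC χ) z v.antiPart * α z u
        - (cderiv (toC χ) z u.holPart * α z v - cderiv (toC χ) z v.holPart * α z u)))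
      = (χ z : ℂ) * complexify (betaLocal ρ L z) u v := by
    intro z
    by_cases hz : z ∈ tsupport χ
    · have hw : ∀ w : CVec n, cderiv (toC χ) z w.holPart = cderiv (toC χ) z w.antiPart
          - Complex.I * ((fderiv ℝ χ z (Complex.I • w.re) : ℂ)
            + Complex.I * (fderiv ℝ χ z (Complex.I • w.im) : ℂ)) := fun w => by
        rw [← fderiv_toC (hχd z), ← fderiv_toC (hχd z), fderiv_I_smul_re]
        simp only [cderiv_eq, CVec.holPart, CVec.antiPart, map_zero]
        linear_combination (dHol (toC χ) z w.hol - dBar (toC χ) z w.anti) * Complex.I_sq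
      simp only [hw, hα, h.alpha_eq (hs hz), h.complexify_betaLocal (hs hz), hΦdef]
      generalize (χ z : ℂ) = c
      ring_nf
      simp only [Complex.I_sq, show Complex.I ^ 3 = -Complex.I by
        rw [pow_succ, Complex.I_sq]; ring, Complex.I_pow_four,
        show Complex.I ^ 5 = Complex.I by rw [pow_succ, Complex.I_pow_four]; ring]
      ring
    · have hχ0 : fderiv ℝ χ z = 0 :=
        image_eq_zero_of_notMem_tsupport fun h => hz (tsupport_fderiv_subset ℝ h)
      have hχC0 : fderiv ℝ (toC χ) z = 0 := by
        ext a; simp [fderiv_toC (hχd z), hχ0]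
      simp [hΦdef, hχ0, cderiv, hχC0, image_eq_zero_of_notMem_tsupport hz]
  have hfin := integral_add e1 hR
  rw [e2, zero_add] at hfin
  rw [← hfin, sub_eq_zero]
  exact integral_congr_ae (Eventually.of_forall fun z => (hpt z).symm)

end IsTransverse

end LocalTheory

/-! ### Derivatives along integral curves -/

section DerivativeAlongCurves

variable {E F : Type*} [NormedAddCommGroup E] [NormedSpace ℝ E] [NormedAddCommGroup F]
  [NormedSpace ℝ F]

theorem HasStrictFDerivAt.tendsto_inv_smul_sub {k : E → F} {k' : E →L[ℝ] F} {z : E}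
    (h : HasStrictFDerivAt k k' z) {γ : ℝ → E} {t₀ : ℝ} (hγ : ContinuousAt γ t₀) (h0 : γ t₀ = z)
    (v : E) :
    Tendsto (fun q : ℝ × ℝ => q.1⁻¹ • (k (γ q.2 + q.1 • v) - k (γ q.2))) (𝓝[≠] 0 ×ˢ 𝓝 t₀)
      (𝓝 (k' v)) := by
  have hγ' : Tendsto (fun q : ℝ × ℝ => γ q.2) (𝓝[≠] 0 ×ˢ 𝓝 t₀) (𝓝 z) :=
    (h0 ▸ hγ.tendsto).comp tendsto_snd
  have h1 : Tendsto (fun q : ℝ × ℝ => q.1) (𝓝[≠] 0 ×ˢ 𝓝 t₀) (𝓝[≠] 0) := tendsto_fst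
  have h2 : Tendsto (fun q : ℝ × ℝ => q.1) (𝓝[≠] 0 ×ˢ 𝓝 t₀) (𝓝 0) := h1.mono_right inf_le_left
  have hpair : Tendsto (fun q : ℝ × ℝ => (γ q.2 + q.1 • v, γ q.2)) (𝓝[≠] 0 ×ˢ 𝓝 t₀)
      (𝓝 (z, z)) := by
    refine Tendsto.prodMk_nhds ?_ hγ'
    simpa using hγ'.add (h2.smul_const v)
  have ho := h.isLittleO.comp_tendsto hpair
  have ho2 : (fun q : ℝ × ℝ => k (γ q.2 + q.1 • v) - k (γ q.2) - q.1 • k' v)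
      =o[𝓝[≠] 0 ×ˢ 𝓝 t₀] fun q => q.1 := by
    refine Asymptotics.IsLittleO.trans_isBigO (g := fun q : ℝ × ℝ => q.1 • v) ?_ ?_
    · simpa [Function.comp_def] using ho
    · exact Asymptotics.IsBigO.of_bound ‖v‖ (Eventually.of_forall fun q => by
        rw [norm_smul, mul_comm])
  have ho3 := ho2.tendsto_inv_smul_nhds_zero
  have hne : ∀ᶠ q : ℝ × ℝ in 𝓝[≠] 0 ×ˢ 𝓝 t₀, q.1 ≠ 0 := h1.eventually self_mem_nhdsWithin
  have ho4 := ho3.add_const (k' v)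
  rw [zero_add] at ho4
  refine ho4.congr' ?_
  filter_upwards [hne] with q hq
  rw [smul_sub, inv_smul_smul₀ hq, sub_add_cancel]

theorem tendsto_clm_apply {ι : Type*} {l : Filter ι} {f : ι → E →L[ℝ] F} {x : ι → E}
    {f₀ : E →L[ℝ] F} {x₀ : E} (hf : Tendsto f l (𝓝 f₀)) (hx : Tendsto x l (𝓝 x₀)) :
    Tendsto (fun i => f i (x i)) l (𝓝 (f₀ x₀)) :=
  (isBoundedBilinearMap_apply.continuous.tendsto (f₀, x₀)).comp (hf.prodMk_nhds hx)

/-- If `u`, the vector field `X` and `X u` are of class `C¹`, then the derivatives of `u` are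
differentiable along integral curves of `X`, and `X (v u) = v (X u) - (v X) u`, although `v u` is
merely continuous. The difference quotients of `u` in the direction `v` are differentiable along
the curve, and their derivatives converge uniformly. -/
theorem hasDerivAt_fderiv_comp_of_isIntegralCurveAt {u : E → F} {X : E → E} {V : Set E}
    (hV : IsOpen V) (hu : ContDiffOn ℝ 1 u V) (hX : ContDiffOn ℝ 1 X V)
    (hk : ContDiffOn ℝ 1 (fun w => fderiv ℝ u w (X w)) V) {γ : ℝ → E} {z : E} (hz : z ∈ V)
    (h0 : γ 0 = z) (hγ : IsIntegralCurveAt γ (fun _ => X) 0) (v : E) :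
    HasDerivAt (fun t => fderiv ℝ u (γ t) v)
      (fderiv ℝ (fun w => fderiv ℝ u w (X w)) z v - fderiv ℝ u z (fderiv ℝ X z v)) 0 := by
  set k : E → F := fun w => fderiv ℝ u w (X w) with hkdef
  have hVz := hV.mem_nhds hz
  have hγc : ContinuousAt γ 0 := hγ.self_of_nhds.continuousAt
  have hγz : Tendsto γ (𝓝 0) (𝓝 z) := h0 ▸ hγc.tendsto
  have hud : ContinuousOn (fderiv ℝ u) V := hu.continuousOn_fderiv_of_isOpen hV le_rfl
  have hXd : ContinuousOn (fderiv ℝ X) V := hX.continuousOn_fderiv_of_isOpen hV le_rfl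
  have hkd : ContinuousOn (fderiv ℝ k) V := hk.continuousOn_fderiv_of_isOpen hV le_rfl
  have hdiff : ∀ w ∈ V, HasFDerivAt u (fderiv ℝ u w) w := fun w hw =>
    ((hu.contDiffAt (hV.mem_nhds hw)).differentiableAt one_ne_zero).hasFDerivAt
  have hγ2 : Tendsto (fun q : ℝ × ℝ => γ q.2) (𝓝[≠] 0 ×ˢ 𝓝 0) (𝓝 z) := hγz.comp tendsto_snd
  have hε : Tendsto (fun q : ℝ × ℝ => q.1) (𝓝[≠] 0 ×ˢ 𝓝 (0 : ℝ)) (𝓝 0) :=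
    tendsto_fst.mono_right inf_le_left
  have hshift : Tendsto (fun q : ℝ × ℝ => γ q.2 + q.1 • v) (𝓝[≠] 0 ×ˢ 𝓝 0) (𝓝 z) := by
    simpa using hγ2.add (hε.smul_const v)
  set g' : ℝ → F := fun t => fderiv ℝ k (γ t) v - fderiv ℝ u (γ t) (fderiv ℝ X (γ t) v) with hg'
  have hg'0 : Tendsto g' (𝓝 0) (𝓝 (g' 0)) := by
    have hmem : V ∈ 𝓝 (γ 0) := h0 ▸ hVz
    exact (tendsto_clm_apply ((hkd.continuousAt hmem).tendsto.comp hγc) tendsto_const_nhds).sub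
      (tendsto_clm_apply ((hud.continuousAt hmem).tendsto.comp hγc)
        (tendsto_clm_apply ((hXd.continuousAt hmem).tendsto.comp hγc) tendsto_const_nhds))
  have hmain := hasDerivAt_of_tendstoUniformlyOnFilter (𝕜 := ℝ) (l := 𝓝[≠] (0 : ℝ)) (x := (0 : ℝ))
    (f := fun ε t => ε⁻¹ • (u (γ t + ε • v) - u (γ t)))
    (f' := fun ε t => ε⁻¹ • (fderiv ℝ u (γ t + ε • v) (X (γ t)) - k (γ t)))
    (g := fun t => fderiv ℝ u (γ t) v) (g' := g') ?_ ?_ ?_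
  · simpa only [hg', h0] using hmain
  · rw [tendstoUniformlyOnFilter_iff_tendsto]
    have hf' : Tendsto (fun q : ℝ × ℝ =>
        q.1⁻¹ • (fderiv ℝ u (γ q.2 + q.1 • v) (X (γ q.2)) - k (γ q.2))) (𝓝[≠] 0 ×ˢ 𝓝 0)
        (𝓝 (g' 0)) := by
      have hk1 := ((hk.contDiffAt hVz).hasStrictFDerivAt one_ne_zero).tendsto_inv_smul_sub
        hγc h0 v
      have hX1 := ((hX.contDiffAt hVz).hasStrictFDerivAt one_ne_zero).tendsto_inv_smul_sub
        hγc h0 v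
      have hu1 := (hud.continuousAt hVz).tendsto.comp hshift
      have := hk1.sub (tendsto_clm_apply hu1 hX1)
      rw [hg']
      simp only [h0]
      refine this.congr fun q => ?_
      simp only [Function.comp_apply, map_smul, map_sub, hkdef, ← smul_sub]
      congr 1
      abel
    have hg2 : Tendsto (fun q : ℝ × ℝ => g' q.2) (𝓝[≠] 0 ×ˢ 𝓝 0) (𝓝 (g' 0)) :=
      hg'0.comp tendsto_snd
    exact (hg2.prodMk_nhds hf').mono_right (nhds_le_uniformity _)
  · have hc : ∀ᶠ q : ℝ × ℝ in 𝓝[≠] 0 ×ˢ 𝓝 0, HasDerivAt γ (X (γ q.2)) q.2 :=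
      tendsto_snd.eventually hγ
    filter_upwards [hγ2.eventually hVz, hshift.eventually hVz, hc] with q h1 h2 h3
    have hd1 := (hdiff _ h2).comp_hasDerivAt q.2 (h3.add_const (q.1 • v))
    have hd2 := (hdiff _ h1).comp_hasDerivAt q.2 h3
    exact (hd1.sub hd2).const_smul q.1⁻¹
  · filter_upwards [hγz.eventually hVz] with t ht
    exact ((hdiff _ ht).hasLineDerivAt v).tendsto_slope_zero

end DerivativeAlongCurves

/-! ### Null vectors of the Levi form -/

section NullVectors

variable {n : ℕ} {ρ : Cn n → ℝ} {L : Cn n → Cn n} {V : Set (Cn n)} {z a b : Cn n}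

theorem dHol_sum_mul_eq_zero {f g : Fin n → Cn n → ℂ} {c : ℂ}
    (hf : ∀ j, DifferentiableAt ℝ (f j) z) (hg : ∀ j, DifferentiableAt ℝ (g j) z)
    (h : ∀ᶠ w in 𝓝 z, ∑ j, f j w * g j w = c) (a : Cn n) :
    ∑ j, (dHol (f j) z a * g j z + f j z * dHol (g j) z a) = 0 := by
  have hD : ∀ x, ∑ j, (fderiv ℝ (f j) z x * g j z + f j z * fderiv ℝ (g j) z x) = 0 := by
    intro x
    have h1 : HasFDerivAt (fun w => ∑ j, f j w * g j w)
        (∑ j, (f j z • fderiv ℝ (g j) z + g j z • fderiv ℝ (f j) z)) z :=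
      HasFDerivAt.fun_sum fun j _ => (hf j).hasFDerivAt.mul (hg j).hasFDerivAt
    have h2 : HasFDerivAt (fun w => ∑ j, f j w * g j w) (0 : Cn n →L[ℝ] ℂ) z :=
      (hasFDerivAt_const c z).congr_of_eventuallyEq h
    have h3 := congrArg (· x) (h1.unique h2)
    simp only [sum_apply, add_apply, smul_apply, smul_eq_mul, zero_apply] at h3
    rw [← h3]
    exact Finset.sum_congr rfl fun j _ => by ring
  have h1 := hD a
  have h2 := hD (Complex.I • a)
  have h3 : ∑ j, (dHol (f j) z a * g j z + f j z * dHol (g j) z a)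
      = (1 / 2 : ℂ) * (∑ j, (fderiv ℝ (f j) z a * g j z + f j z * fderiv ℝ (g j) z a)
        - Complex.I * ∑ j, (fderiv ℝ (f j) z (Complex.I • a) * g j z
          + f j z * fderiv ℝ (g j) z (Complex.I • a))) := by
    simp only [dHol_apply, Finset.mul_sum, ← Finset.sum_sub_distrib]
    exact Finset.sum_congr rfl fun j _ => by ring
  rw [h3, h1, h2]; simp

namespace IsTransverse

theorem dHol_field (h : IsTransverse ρ L V) (hz : z ∈ V) : dHol (toC ρ) z (L z) = 1 := by
  rw [dHol_toC_eq_sum]; exact h.sum_mul_delCoeff z hz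

/-- On null vectors, the Levi form is `∂∂̄ρ(Z_a, conj Z_c) = α(Z_a) conj(∂ρ(Z_c))` for all `c`, since
`c - ∂ρ(Z_c) L` is tangential. -/
theorem deldelbar_of_mem_leviNull (h : IsTransverse ρ L V) (hz : z ∈ V) (ha : a ∈ leviNull ρ z)
    (c : Cn n) :
    deldelbar (toC ρ) z a c = star (dHol (toC ρ) z c) * deldelbar (toC ρ) z a (L z) := by
  have hρ := h.contDiffAt hz
  have h0 := ha.2 (c + (-dHol (toC ρ) z c) • L z) (by
    rw [mem_holTangent, map_add, map_smul, h.dHol_field hz]; simp)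
  rw [deldelbar_add_right hρ, deldelbar_smul_right hρ, star_neg] at h0
  linear_combination h0

theorem deldelbar_of_mem_leviNull_right (h : IsTransverse ρ L V) (hz : z ∈ V)
    (hb : b ∈ leviNull ρ z) (c : Cn n) :
    deldelbar (toC ρ) z c b = dHol (toC ρ) z c * deldelbar (toC ρ) z (L z) b := by
  have hρ := h.contDiffAt hz
  rw [deldelbar_conj hρ b c, h.deldelbar_of_mem_leviNull hz hb, star_mul', star_star,
    ← deldelbar_conj hρ]

theorem differentiableAt_field (h : IsTransverse ρ L V) (hz : z ∈ V) (j : Fin n) :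
    DifferentiableAt ℝ (fun w => L w j) z :=
  (contDiffAt_pi.1 (h.contDiffOn_field.contDiffAt (h.isOpen.mem_nhds hz)) j).differentiableAt
    one_ne_zero

theorem differentiableAt_delCoeff (h : IsTransverse ρ L V) (hz : z ∈ V) (j : Fin n) :
    DifferentiableAt ℝ (fun w => delCoeff ρ w j) z :=
  (contDiffAt_delCoeff (h.contDiffAt hz) j).differentiableAt one_ne_zero

theorem eventually_sum_mul_delCoeff (h : IsTransverse ρ L V) (hz : z ∈ V) :
    ∀ᶠ w in 𝓝 z, ∑ j, L w j * delCoeff ρ w j = 1 :=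
  Filter.mem_of_superset (h.isOpen.mem_nhds hz) fun w hw => h.sum_mul_delCoeff w hw

theorem sum_dHol_star_field_mul (h : IsTransverse ρ L V) (hz : z ∈ V) (a : Cn n) :
    ∑ j, dHol (fun w => star (L w j)) z a * star (delCoeff ρ z j)
      = -deldelbar (toC ρ) z a (L z) := by
  have := dHol_sum_mul_eq_zero (c := 1) (fun j => differentiableAt_star (h.differentiableAt_field hz j))
    (fun j => differentiableAt_star (h.differentiableAt_delCoeff hz j))
    ((h.eventually_sum_mul_delCoeff hz).mono fun w hw => by
      simpa only [star_sum, star_mul', star_one] using congrArg star hw) a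
  rw [Finset.sum_add_distrib, ← dHol_dBar_toC (h.contDiffAt hz), ← deldelbar_eq] at this
  linear_combination this

/-- The second derivative `ρ(L̄, conj Z_b)`, in terms of the derivative of `conj(Z_b) ρ` along `L` and
of `α(conj Z_b)`. -/
theorem dBar_dBar_field (h : IsTransverse ρ L V) (hz : z ∈ V) (b : Cn n) :
    dBar (fun w => dBar (toC ρ) w (L z)) z b
      = fderiv ℝ (fun w => dBar (toC ρ) w b) z (L z) - deldelbar (toC ρ) z (L z) b := by
  rw [fderiv_eq_dHol_add_dBar, deldelbar_eq, dBar_dBar_comm (contDiffAt_toC (h.contDiffAt hz))]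
  ring

theorem sum_dBar_star_field_mul (h : IsTransverse ρ L V) (hz : z ∈ V) (b : Cn n) :
    ∑ j, dBar (fun w => star (L w j)) z b * star (delCoeff ρ z j)
      = -(fderiv ℝ (fun w => dBar (toC ρ) w b) z (L z) - deldelbar (toC ρ) z (L z) b) := by
  have := dHol_sum_mul_eq_zero (c := 1) (h.differentiableAt_field hz)
    (h.differentiableAt_delCoeff hz) (h.eventually_sum_mul_delCoeff hz) b
  rw [← h.dBar_dBar_field hz, dBar_dBar_toC (h.contDiffAt hz)]
  have h2 := congrArg star this
  simp only [star_sum, star_add, star_mul', star_zero, ← dBar_star, Finset.sum_add_distrib] at h2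
  linear_combination h2

theorem complexify_betaLocal_ofHol (h : IsTransverse ρ L V) (hz : z ∈ V)
    (ha : a ∈ leviNull ρ z) (hb : b ∈ leviNull ρ z) :
    complexify (betaLocal ρ L z) (CVec.ofHol a) (CVec.ofHol b) = 0 := by
  have hnull : ∀ {c : Cn n}, c ∈ leviNull ρ z → ∀ j,
      dHol (fun w => star (delCoeff ρ w j)) z c
        = star (delCoeff ρ z j) * deldelbar (toC ρ) z c (L z) := fun hc j => by
    rw [dHol_star_delCoeff, h.deldelbar_of_mem_leviNull hz hc, delCoeff_eq]
  rw [h.complexify_betaLocal_eq_sum hz]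
  simp only [CVec.ofHol, map_zero, sub_zero, Fintype.sum_sum_type, potentialLeft, potentialRight,
    Sum.elim_inl, Sum.elim_inr, dHol_star_coord, mul_zero, Finset.sum_const_zero, add_zero, hnull ha,
    hnull hb, Finset.sum_sub_distrib, ← mul_assoc, ← Finset.sum_mul, h.sum_dHol_star_field_mul hz]
  ring

theorem complexify_betaLocal_ofHol_conj (h : IsTransverse ρ L V) (hz : z ∈ V)
    (ha : a ∈ leviNull ρ z) (b : Cn n) :
    complexify (betaLocal ρ L z) (CVec.ofHol a) (CVec.ofHol b).conj = Complex.I / 2 *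
      (∑ j, dHol (fun w => star (L w j)) z a * dBar (fun w => star (delCoeff ρ w j)) z b
        + deldelbar (toC ρ) z a (L z) * (fderiv ℝ (fun w => dBar (toC ρ) w b) z (L z)
          - deldelbar (toC ρ) z (L z) b)
        - ∑ m, star (b m) * dHol (fun w => star (normalDerivDel ρ L m w)) z a) := by
  have hneg : ∀ (f : Cn n → ℂ) c, dHol (fun w => -f w) z c = -dHol f z c := fun f c => by
    simp only [dHol_apply, fderiv_fun_neg, neg_apply]; ring
  have hnull : ∀ j, dHol (fun w => star (delCoeff ρ w j)) z a
        = star (delCoeff ρ z j) * deldelbar (toC ρ) z a (L z) := fun j => by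
    rw [dHol_star_delCoeff, h.deldelbar_of_mem_leviNull hz ha, delCoeff_eq]
  rw [h.complexify_betaLocal_eq_sum hz]
  simp only [CVec.ofHol, CVec.conj, map_zero, sub_zero, zero_sub, Fintype.sum_sum_type,
    potentialLeft, potentialRight, Sum.elim_inl, Sum.elim_inr, dHol_star_coord, dBar_star_coord, mul_zero, hneg,
    hnull, Finset.sum_sub_distrib, ← mul_assoc, ← Finset.sum_mul, neg_mul, mul_neg,
    Finset.sum_neg_distrib, h.sum_dBar_star_field_mul hz, Finset.sum_const_zero]
  simp only [mul_comm (star (b _))]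
  ring

/-- The third derivative of `ρ` along `X = Re Z_L`, `Z_a` and `conj Z_b`. -/
theorem hasDerivAt_deldelbar (h : IsTransverse ρ L V) (hz : z ∈ V) (a b : Cn n) {γ : ℝ → Cn n}
    (h0 : γ 0 = z) (hγ : IsIntegralCurveAt γ (fun _ w => (1 / 2 : ℂ) • L w) 0) :
    HasDerivAt (fun t => deldelbar (toC ρ) (γ t) a b)
      ((1 / 2 : ℂ) * (∑ m, star (b m) * dHol (fun w => star (normalDerivDel ρ L m w)) z a
        - ∑ j, dHol (fun w => L w j) z a * deldelbar (toC ρ) z (Pi.single j 1) b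
        - ∑ j, dHol (fun w => star (L w j)) z a
          * dBar (fun w => star (delCoeff ρ w j)) z b)) 0 := by
  set u : Cn n → ℂ := fun w => dBar (toC ρ) w b with hu
  set X : Cn n → Cn n := fun w => (1 / 2 : ℂ) • L w with hX
  have hVz := h.isOpen.mem_nhds hz
  have huV : ContDiffOn ℝ 1 u V := fun w hw =>
    (contDiffAt_dBar (contDiffAt_toC (h.contDiffAt hw)) b).contDiffWithinAt
  have hXV : ContDiffOn ℝ 1 X V := h.contDiffOn_field.const_smul (1 / 2 : ℂ)
  have hκ : ∀ m, ContDiffOn ℝ 1 (fun w => star (normalDerivDel ρ L m w)) V := fun m w hw =>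
    (contDiffAt_star ((h.contDiffOn_normalDerivDel m).contDiffAt
      (h.isOpen.mem_nhds hw))).contDiffWithinAt
  have hkeq : ∀ w ∈ V, fderiv ℝ u w (X w)
      = ∑ m, (1 / 2 * star (b m)) * star (normalDerivDel ρ L m w) := fun w hw => by
    rw [hX, fderiv_half_smul, fderiv_dBar_toC (h.contDiffAt hw), Finset.mul_sum]
    exact Finset.sum_congr rfl fun m _ => by rw [star_normalDerivDel, mul_assoc]
  have hkV : ContDiffOn ℝ 1 (fun w => fderiv ℝ u w (X w)) V :=
    ContDiffOn.congr (ContDiffOn.sum fun m _ => contDiffOn_const.mul (hκ m)) hkeq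
  have hkd : ∀ x, fderiv ℝ (fun w => fderiv ℝ u w (X w)) z x
      = ∑ m, (1 / 2 * star (b m)) * fderiv ℝ (fun w => star (normalDerivDel ρ L m w)) z x := by
    intro x
    have hd : ∀ m, DifferentiableAt ℝ (fun w => star (normalDerivDel ρ L m w)) z := fun m =>
      ((hκ m).contDiffAt hVz).differentiableAt one_ne_zero
    rw [(Filter.eventuallyEq_of_mem hVz hkeq).fderiv_eq,
      fderiv_fun_sum fun m _ => (hd m).const_mul _, sum_apply]
    refine Finset.sum_congr rfl fun m _ => ?_
    rw [fderiv_const_mul (hd m)]; rfl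
  have hLd : DifferentiableAt ℝ L z := (h.contDiffOn_field.contDiffAt hVz).differentiableAt
    one_ne_zero
  have hXd : ∀ x, fderiv ℝ u z (fderiv ℝ X z x) = 1 / 2 *
      (∑ j, fderiv ℝ (fun w => L w j) z x * deldelbar (toC ρ) z (Pi.single j 1) b
        + ∑ j, fderiv ℝ (fun w => star (L w j)) z x
          * dBar (fun w => star (delCoeff ρ w j)) z b) := by
    intro x
    have hcomp : ∀ j, fderiv ℝ L z x j = fderiv ℝ (fun w => L w j) z x := fun j => by
      rw [fderiv_apply hLd]; rfl
    rw [hX, fderiv_fun_const_smul hLd, smul_apply, fderiv_half_smul, fderiv_eq_dHol_add_dBar,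
      dHol_eq_sum, dBar_eq_sum]
    congr 2
    · exact Finset.sum_congr rfl fun j _ => by rw [hcomp, hu, deldelbar_eq]
    · refine Finset.sum_congr rfl fun j _ => ?_
      rw [hcomp, fderiv_star_apply, hu, dBar_dBar_comm (contDiffAt_toC (h.contDiffAt hz))]
      simp only [delCoeff_eq, dBar_toC]
  have hD := fun v => hasDerivAt_fderiv_comp_of_isIntegralCurveAt h.isOpen huV hXV hkV hz h0 hγ v
  have hD2 := (((hD a).sub ((hD (Complex.I • a)).const_mul Complex.I)).const_mul (1 / 2 : ℂ))
  simp only [hkd, hXd] at hD2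
  have hfun : (fun t => deldelbar (toC ρ) (γ t) a b)
      = fun t => (1 / 2 : ℂ) * (fderiv ℝ u (γ t) a - Complex.I * fderiv ℝ u (γ t) (Complex.I • a)) :=
    by funext t; rw [deldelbar_eq, dHol_apply]
  rw [hfun]
  refine HasDerivAt.congr_deriv hD2 ?_
  have e1 : ∀ (c : Fin n → ℂ) (f : Fin n → Cn n → ℂ), ∑ j, dHol (f j) z a * c j
      = (1 / 2 : ℂ) * (∑ j, fderiv ℝ (f j) z a * c j
        - Complex.I * ∑ j, fderiv ℝ (f j) z (Complex.I • a) * c j) := fun c f => by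
    simp only [dHol_apply, Finset.mul_sum, ← Finset.sum_sub_distrib]
    exact Finset.sum_congr rfl fun j _ => by ring
  have e2 : ∀ x, ∑ m, 1 / 2 * star (b m) * fderiv ℝ (fun w => star (normalDerivDel ρ L m w)) z x
      = 1 / 2 * ∑ m, fderiv ℝ (fun w => star (normalDerivDel ρ L m w)) z x * star (b m) := fun x => by
    rw [Finset.mul_sum]
    exact Finset.sum_congr rfl fun j _ => by ring
  have e3 : ∑ m, star (b m) * dHol (fun w => star (normalDerivDel ρ L m w)) z a
      = ∑ m, dHol (fun w => star (normalDerivDel ρ L m w)) z a * star (b m) :=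
    Finset.sum_congr rfl fun m _ => mul_comm _ _
  rw [e3, e1, e1, e1, e2, e2]
  ring

end IsTransverse

end NullVectors

/-! ### Inverses of matrix functions -/

section SmoothMatrices

variable {n : ℕ}

theorem contDiffAt_det {E ι : Type*} [NormedAddCommGroup E] [NormedSpace ℝ E] [Fintype ι]
    [DecidableEq ι] {k : WithTop ℕ∞} {A : E → Matrix ι ι ℂ} {z : E}
    (hA : ∀ i j, ContDiffAt ℝ k (fun w => A w i j) z) : ContDiffAt ℝ k (fun w => (A w).det) z := by
  simp only [Matrix.det_apply']
  exact ContDiffAt.sum fun σ _ => contDiffAt_const.mul (contDiffAt_prod fun i _ => hA _ _)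

theorem contDiffAt_matrix_inv_apply {E ι : Type*} [NormedAddCommGroup E] [NormedSpace ℝ E]
    [Fintype ι] [DecidableEq ι] {k : WithTop ℕ∞} {A : E → Matrix ι ι ℂ} {z : E}
    (hA : ∀ i j, ContDiffAt ℝ k (fun w => A w i j) z) (h0 : (A z).det ≠ 0) (i j : ι) :
    ContDiffAt ℝ k (fun w => (A w)⁻¹ i j) z := by
  simp only [Matrix.inv_def, Matrix.smul_apply, Ring.inverse_eq_inv', smul_eq_mul,
    Matrix.adjugate_apply]
  refine ((contDiffAt_det hA).inv h0).mul (contDiffAt_det fun i' j' => ?_)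
  by_cases h : i' = j
  · subst h
    simp only [Matrix.updateRow_self]
    exact contDiffAt_const
  · simp only [Matrix.updateRow_ne h]
    exact hA i' j'

end SmoothMatrices

/-! ### Hermitian metrics in a chart -/

section Metric

variable {n : ℕ} {G : Cn n → Matrix (Fin n) (Fin n) ℂ} {ρ : Cn n → ℝ} {V : Set (Cn n)} {z : Cn n}

/-- The coordinate matrices of a Hermitian metric of class `C²` on the set `V`. -/
structure IsHermitianMatrixField (G : Cn n → Matrix (Fin n) (Fin n) ℂ) (V : Set (Cn n)) :
    Prop where
  contDiffOn : ∀ j k, ContDiffOn ℝ 2 (fun w => G w j k) V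
  isHermitian : ∀ z ∈ V, (G z).IsHermitian
  pos : ∀ z ∈ V, ∀ a : Cn n, a ≠ 0 → 0 < (herm G z a a).re

theorem herm_eq (G : Cn n → Matrix (Fin n) (Fin n) ℂ) (z a b : Cn n) :
    herm G z a b = a ⬝ᵥ (G z *ᵥ star b) := by
  simp only [herm, dotProduct, Matrix.mulVec, Finset.mul_sum, Pi.star_apply]
  exact Finset.sum_congr rfl fun j _ => Finset.sum_congr rfl fun k _ => by ring

theorem dHol_mul {f g : Cn n → ℂ} (hf : DifferentiableAt ℝ f z) (hg : DifferentiableAt ℝ g z)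
    (a : Cn n) : dHol (fun w => f w * g w) z a = dHol f z a * g z + f z * dHol g z a := by
  simp only [dHol_apply, fderiv_fun_mul hf hg, add_apply, smul_apply, smul_eq_mul]
  ring

theorem dHol_sum {ι : Type*} {s : Finset ι} {f : ι → Cn n → ℂ}
    (hf : ∀ i, DifferentiableAt ℝ (f i) z) (a : Cn n) :
    dHol (fun w => ∑ i ∈ s, f i w) z a = ∑ i ∈ s, dHol (f i) z a := by
  simp only [dHol_apply, fderiv_fun_sum fun i _ => hf i, sum_apply, Finset.mul_sum,
    ← Finset.sum_sub_distrib]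

theorem normSqD_eq (G : Cn n → Matrix (Fin n) (Fin n) ℂ) (ρ : Cn n → ℝ) (z : Cn n) :
    normSqD G ρ z = 2 * normSqDel G ρ z := rfl

theorem vecX_eq (G : Cn n → Matrix (Fin n) (Fin n) ℂ) (ρ : Cn n → ℝ) (z : Cn n) :
    vecX G ρ z = (1 / 2 : ℂ) • vecL G ρ z := by
  rw [vecX, vecL, normSqD_eq, smul_smul]
  congr 1
  push_cast
  rw [mul_inv]
  ring

namespace IsHermitianMatrixField

theorem det_ne_zero (h : IsHermitianMatrixField G V) (hz : z ∈ V) : (G z).det ≠ 0 := by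
  intro h0
  obtain ⟨v, hv, hv0⟩ := Matrix.exists_mulVec_eq_zero_iff.2 h0
  have := h.pos z hz (star v) (by simpa using hv)
  rw [herm_eq, star_star, hv0] at this
  simp at this

theorem herm_gradVec (h : IsHermitianMatrixField G V) (hz : z ∈ V) (a : Cn n) :
    herm G z a (gradVec G ρ z) = dHol (toC ρ) z a := by
  rw [herm_eq, gradVec, star_star, Matrix.mulVec_mulVec,
    Matrix.mul_nonsing_inv _ (isUnit_iff_ne_zero.2 (h.det_ne_zero hz)), Matrix.one_mulVec,
    dHol_toC_eq_sum]
  rfl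

theorem eq_gradVec (h : IsHermitianMatrixField G V) (hz : z ∈ V) {v : Cn n}
    (hv : ∀ a, herm G z a v = dHol (toC ρ) z a) : v = gradVec G ρ z := by
  by_contra hne
  have := h.pos z hz (v - gradVec G ρ z) (sub_ne_zero.2 hne)
  have h0 : herm G z (v - gradVec G ρ z) (v - gradVec G ρ z) = 0 := by
    have h1 := hv (v - gradVec G ρ z)
    rw [← h.herm_gradVec hz, herm_eq, herm_eq] at h1
    rw [herm_eq, star_sub, Matrix.mulVec_sub, dotProduct_sub, h1, sub_self]
  rw [h0] at this
  simp at this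

theorem coe_normSqDel (h : IsHermitianMatrixField G V) (hz : z ∈ V) :
    (normSqDel G ρ z : ℂ) = dHol (toC ρ) z (gradVec G ρ z) := by
  rw [← h.herm_gradVec hz, normSqDel]
  refine Complex.conj_eq_iff_re.1 ?_
  rw [herm, map_sum, Finset.sum_comm]
  refine Finset.sum_congr rfl fun j _ => ?_
  rw [map_sum]
  refine Finset.sum_congr rfl fun k _ => ?_
  have hG : (starRingEnd ℂ) (G z j k) = G z k j := (h.isHermitian z hz).apply k j
  simp only [map_mul, hG, Complex.star_def, Complex.conj_conj]
  ring

theorem normSqDel_pos (h : IsHermitianMatrixField G V) (hz : z ∈ V)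
    (hρ : DifferentiableAt ℝ ρ z) (h0 : fderiv ℝ ρ z ≠ 0) : 0 < normSqDel G ρ z := by
  refine h.pos z hz _ fun hN => h0 ?_
  have hd : ∀ a, dHol (toC ρ) z a = 0 := fun a => by
    rw [← h.herm_gradVec hz, hN, herm_eq]; simp
  ext a
  have := fderiv_toC hρ a
  rw [fderiv_eq_dHol_add_dBar, dBar_toC, hd] at this
  simpa using this.symm

theorem gradVec_apply (G : Cn n → Matrix (Fin n) (Fin n) ℂ) (ρ : Cn n → ℝ) (z : Cn n) (j : Fin n) :
    gradVec G ρ z j = ∑ k, star ((G z)⁻¹ j k) * star (delCoeff ρ z k) := by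
  simp only [gradVec, Pi.star_apply, Matrix.mulVec, dotProduct, star_sum, star_mul']

theorem star_gradVec_apply (h : IsHermitianMatrixField G V) (hz : z ∈ V) (k : Fin n) :
    star (gradVec G ρ z k) = ∑ j, star ((G z)⁻¹ j k) * delCoeff ρ z j := by
  simp only [gradVec, Pi.star_apply, star_star, Matrix.mulVec, dotProduct]
  exact Finset.sum_congr rfl fun j _ => by rw [(h.isHermitian z hz).inv.apply]

theorem coe_normSqDel_eq_sum (h : IsHermitianMatrixField G V) (hz : z ∈ V) :
    (normSqDel G ρ z : ℂ)
      = ∑ j, ∑ k, star ((G z)⁻¹ j k) * star (delCoeff ρ z k) * delCoeff ρ z j := by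
  rw [h.coe_normSqDel hz, dHol_toC_eq_sum]
  simp only [gradVec_apply, Finset.sum_mul]

/-- Differentiating `|∂ρ|² = ∑ⱼₖ G^{jk̄} ρⱼ ρ_k̄` expresses the derivative of `∂ρ/∂z_m` along the
gradient through first derivatives of `|∂ρ|²` and of the metric, as second derivatives of `ρ`
commute and `G⁻¹` is Hermitian. -/
theorem fderiv_delCoeff_gradVec (h : IsHermitianMatrixField G V) (hV : IsOpen V)
    (hρ : ContDiffOn ℝ 2 ρ V) (hz : z ∈ V) (m : Fin n) :
    fderiv ℝ (fun w => delCoeff ρ w m) z (gradVec G ρ z)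
      = dHol (toC (normSqDel G ρ)) z (Pi.single m 1)
        - ∑ j, ∑ k, dHol (fun w => star ((G w)⁻¹ j k)) z (Pi.single m 1)
          * star (delCoeff ρ z k) * delCoeff ρ z j := by
  have hρz := hρ.contDiffAt (hV.mem_nhds hz)
  have hp : ∀ j, DifferentiableAt ℝ (fun w => delCoeff ρ w j) z := fun j =>
    (contDiffAt_delCoeff hρz j).differentiableAt one_ne_zero
  have hq : ∀ j, DifferentiableAt ℝ (fun w => star (delCoeff ρ w j)) z := fun j =>
    differentiableAt_star (hp j)
  have hK : ∀ j k, DifferentiableAt ℝ (fun w => star ((G w)⁻¹ j k)) z := fun j k =>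
    differentiableAt_star ((contDiffAt_matrix_inv_apply
      (fun i j => (h.contDiffOn i j).contDiffAt (hV.mem_nhds hz))
      (h.det_ne_zero hz) j k).differentiableAt two_ne_zero)
  have hev : toC (normSqDel G ρ) =ᶠ[𝓝 z] fun w =>
      ∑ j, ∑ k, star ((G w)⁻¹ j k) * star (delCoeff ρ w k) * delCoeff ρ w j :=
    Filter.eventuallyEq_of_mem (hV.mem_nhds hz) fun w hw => h.coe_normSqDel_eq_sum hw
  have hKq : ∀ j k, DifferentiableAt ℝ
      (fun w => star ((G w)⁻¹ j k) * star (delCoeff ρ w k)) z := fun j k => (hK j k).mul (hq k)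
  have hKqp : ∀ j k, DifferentiableAt ℝ
      (fun w => star ((G w)⁻¹ j k) * star (delCoeff ρ w k) * delCoeff ρ w j) z :=
    fun j k => (hKq j k).mul (hp j)
  have hd : dHol (toC (normSqDel G ρ)) z (Pi.single m 1) = ∑ j, ∑ k,
      ((dHol (fun w => star ((G w)⁻¹ j k)) z (Pi.single m 1) * star (delCoeff ρ z k)
        + star ((G z)⁻¹ j k) * dHol (fun w => star (delCoeff ρ w k)) z (Pi.single m 1))
          * delCoeff ρ z j
        + star ((G z)⁻¹ j k) * star (delCoeff ρ z k)
          * dHol (fun w => delCoeff ρ w j) z (Pi.single m 1)) := by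
    rw [dHol_apply, hev.fderiv_eq, ← dHol_apply, dHol_sum fun j =>
      DifferentiableAt.fun_sum fun k _ => hKqp j k]
    refine Finset.sum_congr rfl fun j _ => ?_
    rw [dHol_sum fun k => hKqp j k]
    refine Finset.sum_congr rfl fun k _ => ?_
    rw [dHol_mul (hKq j k) (hp j), dHol_mul (hK j k) (hq k)]
  have hpj : ∀ j, dHol (fun w => delCoeff ρ w j) z (Pi.single m 1)
      = dHol (fun w => delCoeff ρ w m) z (Pi.single j 1) := fun j => by
    simp only [delCoeff_eq]
    exact dHol_dHol_comm (contDiffAt_toC hρz) _ _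
  have hqk : ∀ k, dHol (fun w => star (delCoeff ρ w k)) z (Pi.single m 1)
      = dBar (fun w => delCoeff ρ w m) z (Pi.single k 1) := fun k => by
    rw [dHol_star_delCoeff, deldelbar_eq, dHol_dBar_comm (contDiffAt_toC hρz)]
    simp only [delCoeff_eq]
  rw [hd, fderiv_eq_dHol_add_dBar, dHol_eq_sum, dBar_eq_sum]
  simp only [h.star_gradVec_apply hz]
  simp only [gradVec_apply, hpj, hqk, add_mul, Finset.sum_add_distrib,
    Finset.sum_mul]
  rw [Finset.sum_comm (f := fun x i => star ((G z)⁻¹ i x) * delCoeff ρ z i *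
    dBar (fun w => delCoeff ρ w m) z (Pi.single x 1))]
  have hc : ∑ y, ∑ x, star ((G z)⁻¹ y x) * delCoeff ρ z y *
      dBar (fun w => delCoeff ρ w m) z (Pi.single x 1) = ∑ y, ∑ x, star ((G z)⁻¹ y x) *
      dBar (fun w => delCoeff ρ w m) z (Pi.single x 1) * delCoeff ρ z y :=
    Finset.sum_congr rfl fun j _ => Finset.sum_congr rfl fun k _ => by ring
  rw [hc]
  ring

theorem isTransverse (h : IsHermitianMatrixField G V) (hV : IsOpen V) (hρ : ContDiffOn ℝ 2 ρ V)
    (h0 : ∀ z ∈ V, fderiv ℝ ρ z ≠ 0)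
    (hadm : ContDiffOn ℝ 2 (fun z => Real.sqrt (normSqD G ρ z)) V) :
    IsTransverse ρ (vecL G ρ) V := by
  have hρz : ∀ z ∈ V, ContDiffAt ℝ 2 ρ z := fun z hz => hρ.contDiffAt (hV.mem_nhds hz)
  have hpos : ∀ z ∈ V, 0 < normSqDel G ρ z := fun z hz =>
    h.normSqDel_pos hz ((hρz z hz).differentiableAt two_ne_zero) (h0 z hz)
  have hn : ∀ z ∈ V, ContDiffAt ℝ 2 (normSqDel G ρ) z := fun z hz => by
    have h1 := ((hadm.contDiffAt (hV.mem_nhds hz)).pow 2).const_smul (1 / 2 : ℝ)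
    refine h1.congr_of_eventuallyEq (Filter.eventuallyEq_of_mem (hV.mem_nhds hz) fun w hw => ?_)
    have := Real.sq_sqrt (by rw [normSqD_eq]; linarith [hpos w hw] : 0 ≤ normSqD G ρ w)
    rw [this, normSqD_eq, smul_eq_mul]
    ring
  have hp : ∀ z ∈ V, ∀ j, ContDiffAt ℝ 1 (fun w => delCoeff ρ w j) z := fun z hz j =>
    contDiffAt_delCoeff (hρz z hz) j
  have hK : ∀ z ∈ V, ∀ j k, ContDiffAt ℝ 2 (fun w => star ((G w)⁻¹ j k)) z := fun z hz j k =>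
    contDiffAt_star (contDiffAt_matrix_inv_apply
      (fun i j => (h.contDiffOn i j).contDiffAt (hV.mem_nhds hz)) (h.det_ne_zero hz) j k)
  have hinv : ∀ z ∈ V, ContDiffAt ℝ 1 (fun w => (((normSqDel G ρ w)⁻¹ : ℝ) : ℂ)) z := fun z hz =>
    Complex.ofRealCLM.contDiff.contDiffAt.comp z
      (((hn z hz).of_le one_le_two).inv (hpos z hz).ne')
  refine ⟨hV, hρ, fun z hz => ?_, fun m z hz => ?_, fun z hz => ?_⟩
  · refine ContDiffAt.contDiffWithinAt (contDiffAt_pi.2 fun j => (hinv z hz).mul ?_)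
    simp only [gradVec_apply]
    exact ContDiffAt.sum fun k _ => ((hK z hz j k).of_le one_le_two).mul
      (contDiffAt_star (hp z hz k))
  · refine ContDiffAt.contDiffWithinAt ?_
    have hC : ContDiffAt ℝ 1 (fun w => (((normSqDel G ρ w)⁻¹ : ℝ) : ℂ)
        * (dHol (toC (normSqDel G ρ)) w (Pi.single m 1)
        - ∑ j, ∑ k, dHol (fun w => star ((G w)⁻¹ j k)) w (Pi.single m 1)
          * star (delCoeff ρ w k) * delCoeff ρ w j)) z :=
      (hinv z hz).mul ((contDiffAt_dHol (contDiffAt_toC (hn z hz)) _).sub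
        (ContDiffAt.sum fun j _ => ContDiffAt.sum fun k _ =>
          ((contDiffAt_dHol (hK z hz j k) _).mul (contDiffAt_star (hp z hz k))).mul (hp z hz j)))
    refine hC.congr_of_eventuallyEq (Filter.eventuallyEq_of_mem (hV.mem_nhds hz) fun w hw => ?_)
    simp only [normalDerivDel, vecL]
    rw [← h.fderiv_delCoeff_gradVec hV hρ hw, Complex.coe_smul, map_smul, Complex.real_smul]
  · rw [← dHol_toC_eq_sum, vecL, map_smul, ← h.coe_normSqDel hz, smul_eq_mul, Complex.ofReal_inv,
      inv_mul_cancel₀ (Complex.ofReal_ne_zero.2 (hpos z hz).ne')]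

end IsHermitianMatrixField

theorem christoffel_zero_left (G : Cn n → Matrix (Fin n) (Fin n) ℂ) (z b : Cn n) :
    christoffel G z 0 b = 0 := by
  have : (Matrix.of fun j k => cderiv (fun w => G w j k) z (CVec.ofHol 0)) = 0 := by
    ext j k; simp [cderiv_ofHol]
  rw [christoffel, this, Matrix.vecMul_zero, Matrix.zero_vecMul]

theorem christoffel_zero_right (G : Cn n → Matrix (Fin n) (Fin n) ℂ) (z a : Cn n) :
    christoffel G z a 0 = 0 := by
  rw [christoffel, Matrix.zero_vecMul, Matrix.zero_vecMul]

theorem hess_ofHol_conj (G : Cn n → Matrix (Fin n) (Fin n) ℂ) (f : Cn n → ℂ) (z a b : Cn n) :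
    hess G f z (CVec.ofHol a) (CVec.ofHol b).conj = deldelbar f z a b := by
  rw [hess, deldelbar]
  simp [covConst, CVec.ofHol, CVec.conj, christoffel_zero_left, christoffel_zero_right, cderiv_eq]

theorem covConst_ofReal_ofHol (G : Cn n → Matrix (Fin n) (Fin n) ℂ) (z x a : Cn n) :
    covConst G z (CVec.ofReal x) (CVec.ofHol a) = CVec.ofHol (christoffel G z x a) := by
  simp [covConst, CVec.ofHol, CVec.ofReal, christoffel_zero_right]

theorem covConst_ofReal_conj (G : Cn n → Matrix (Fin n) (Fin n) ℂ) (z x b : Cn n) :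
    covConst G z (CVec.ofReal x) (CVec.ofHol b).conj = (CVec.ofHol (christoffel G z x b)).conj := by
  simp [covConst, CVec.ofHol, CVec.ofReal, CVec.conj, christoffel_zero_right]

/-- The formula for `β` at null vectors `Z_a`, `Z_b` of the Levi form. The Christoffel symbols of the
Chern connection cancel on its right-hand side. -/
theorem exists_hasThirdHess (ht : IsTransverse ρ (vecL G ρ) V) (hz : z ∈ V) {a b : Cn n}
    (ha : a ∈ leviNull ρ z) (hb : b ∈ leviNull ρ z) :
    ∃ c : ℂ, HasThirdHess G (toC ρ) (vecX G ρ) z (CVec.ofHol a) (CVec.ofHol b).conj c ∧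
      complexify (betaLocal ρ (vecL G ρ) z) (CVec.ofHol a) (CVec.ofHol b).conj =
        -Complex.I * c
        - Complex.I * alphaForm G ρ z (CVec.ofHol a) * alphaForm G ρ z (CVec.ofHol b).conj
        + Complex.I * hess G (toC ρ) z (CVec.ofReal (vecX G ρ z)) (CVec.ofHol a)
          * alphaForm G ρ z (CVec.ofHol b).conj
        + Complex.I * alphaForm G ρ z (CVec.ofHol a)
          * hess G (toC ρ) z (CVec.ofReal (vecX G ρ z)) (CVec.ofHol b).conj := by
  have hρ := ht.contDiffAt hz
  have hX : vecX G ρ = fun w => (1 / 2 : ℂ) • vecL G ρ w := funext (vecX_eq G ρ)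
  have hXz : vecX G ρ z = (1 / 2 : ℂ) • vecL G ρ z := vecX_eq G ρ z
  have hXc : ContDiffAt ℝ 1 (vecX G ρ) z := by
    rw [hX]
    exact (ht.contDiffOn_field.contDiffAt (ht.isOpen.mem_nhds hz)).const_smul (1 / 2 : ℂ)
  have hder : HasDerivAlong (vecX G ρ)
      (fun w => hess G (toC ρ) w (CVec.ofHol a) (CVec.ofHol b).conj) z
      ((1 / 2 : ℂ) * (∑ m, star (b m) *
          dHol (fun w => star (normalDerivDel ρ (vecL G ρ) m w)) z a
        - ∑ j, dHol (fun w => vecL G ρ w j) z a * deldelbar (toC ρ) z (Pi.single j 1) b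
        - ∑ j, dHol (fun w => star (vecL G ρ w j)) z a
          * dBar (fun w => star (delCoeff ρ w j)) z b)) := by
    refine ⟨?_, fun γ h0 hγ => ?_⟩
    · obtain ⟨R, hR, ε, hε, hsol⟩ :=
        hXc.exists_forall_mem_closedBall_exists_eq_forall_mem_Ioo_hasDerivAt 0
      obtain ⟨γ, h0, hγ⟩ := hsol z (Metric.mem_closedBall_self hR.le)
      exact ⟨γ, h0, Filter.mem_of_superset (Ioo_mem_nhds (by linarith) (by linarith)) hγ⟩
    · simp only [hess_ofHol_conj]
      exact ht.hasDerivAt_deldelbar hz a b h0 (by rwa [hX] at hγ)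
  refine ⟨_, ⟨_, hder, rfl⟩, ?_⟩
  have hΓ : ∀ c, deldelbar (toC ρ) z c b
      = dHol (toC ρ) z c * deldelbar (toC ρ) z (vecL G ρ z) b :=
    ht.deldelbar_of_mem_leviNull_right hz hb
  have hαa : alphaForm G ρ z (CVec.ofHol a) = deldelbar (toC ρ) z a (vecL G ρ z) := by
    have : deldelbar (toC ρ) z (vecL G ρ z) 0 = 0 := by
      rw [deldelbar_conj hρ, deldelbar_eq, map_zero, star_zero]
    simp [alphaForm, CVec.ofHol, this]
  have hαb : alphaForm G ρ z (CVec.ofHol b).conj = deldelbar (toC ρ) z (vecL G ρ z) b := by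
    have : deldelbar (toC ρ) z 0 (vecL G ρ z) = 0 := by rw [deldelbar_eq, map_zero]
    simp [alphaForm, CVec.ofHol, CVec.conj, this]
  have hHa : hess G (toC ρ) z (CVec.ofReal (vecX G ρ z)) (CVec.ofHol a)
      = 1 / 2 * fderiv ℝ (fun w => dHol (toC ρ) w a) z (vecL G ρ z)
        - dHol (toC ρ) z (christoffel G z (vecX G ρ z) a) := by
    rw [hess, covConst_ofReal_ofHol, cderiv_ofReal, cderiv_ofHol, hXz, fderiv_half_smul]
    simp only [cderiv_ofHol]
  have hHb : hess G (toC ρ) z (CVec.ofReal (vecX G ρ z)) (CVec.ofHol b).conj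
      = 1 / 2 * fderiv ℝ (fun w => dBar (toC ρ) w b) z (vecL G ρ z)
        - star (dHol (toC ρ) z (christoffel G z (vecX G ρ z) b)) := by
    rw [hess, covConst_ofReal_conj, cderiv_ofReal, cderiv_conj_ofHol, hXz, fderiv_half_smul,
      dBar_toC]
    simp only [cderiv_conj_ofHol]
  have hS : ∑ j, dHol (fun w => vecL G ρ w j) z a * deldelbar (toC ρ) z (Pi.single j 1) b
      = -(fderiv ℝ (fun w => dHol (toC ρ) w a) z (vecL G ρ z)
        - deldelbar (toC ρ) z a (vecL G ρ z)) * deldelbar (toC ρ) z (vecL G ρ z) b := by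
    have h1 := ht.sum_dBar_star_field_mul hz a
    simp only [dBar_star, dBar_toC, fderiv_star_apply] at h1
    rw [deldelbar_conj hρ a (vecL G ρ z)] at h1
    have h2 := congrArg star h1
    simp only [star_sum, star_mul', star_neg, star_sub, star_star] at h2
    simp only [hΓ (Pi.single _ _), ← delCoeff_eq, ← mul_assoc, ← Finset.sum_mul, h2]
  rw [ht.complexify_betaLocal_ofHol_conj hz ha b, covConst_ofReal_ofHol, covConst_ofReal_conj,
    hess_ofHol_conj, hess_ofHol_conj, hΓ (christoffel _ _ _ _),
    ht.deldelbar_of_mem_leviNull hz ha (christoffel _ _ _ _), hαa, hαb, hHa, hHb, hS]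
  ring

end Metric

/-! ### Holomorphic changes of coordinates -/

section CoordinateChange

variable {n : ℕ} {F : Cn n → Cn n} {z : Cn n}

theorem fderiv_comp_holomorphic {g : Cn n → ℂ} (hF : DifferentiableAt ℂ F z)
    (hg : DifferentiableAt ℝ g (F z)) (x : Cn n) :
    fderiv ℝ (fun w => g (F w)) z x = fderiv ℝ g (F z) (fderiv ℂ F z x) :=
  congrArg (· x) (hg.hasFDerivAt.comp z (hF.hasFDerivAt.restrictScalars ℝ)).fderiv

theorem dHol_comp_holomorphic {g : Cn n → ℂ} (hF : DifferentiableAt ℂ F z)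
    (hg : DifferentiableAt ℝ g (F z)) (a : Cn n) :
    dHol (fun w => g (F w)) z a = dHol g (F z) (fderiv ℂ F z a) := by
  simp only [dHol_apply, fderiv_comp_holomorphic hF hg, map_smul]

theorem dBar_comp_holomorphic {g : Cn n → ℂ} (hF : DifferentiableAt ℂ F z)
    (hg : DifferentiableAt ℝ g (F z)) (b : Cn n) :
    dBar (fun w => g (F w)) z b = dBar g (F z) (fderiv ℂ F z b) := by
  simp only [dBar_apply, fderiv_comp_holomorphic hF hg, map_smul]

theorem dHol_star_holomorphic {f : Cn n → ℂ} (hf : DifferentiableAt ℂ f z) (a : Cn n) :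
    dHol (fun w => star (f w)) z a = 0 := by
  have h : fderiv ℝ f z = (fderiv ℂ f z).restrictScalars ℝ :=
    (hf.hasFDerivAt.restrictScalars ℝ).fderiv
  rw [dHol_star, dBar_apply, h]
  simp only [ContinuousLinearMap.coe_restrictScalars', map_smul, smul_eq_mul, ← mul_assoc,
    Complex.I_mul_I]
  simp

/-- The complex Hessian is invariant under holomorphic changes of coordinates, as these are
annihilated by `∂̄`. -/
theorem deldelbar_comp_holomorphic {ρ ρ' : Cn n → ℝ} (hF : ContDiffAt ℂ 2 F z)
    (hρ' : ContDiffAt ℝ 2 ρ' (F z)) (hρ : ∀ᶠ w in 𝓝 z, ρ w = ρ' (F w)) (a b : Cn n) :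
    deldelbar (toC ρ) z a b
      = deldelbar (toC ρ') (F z) (fderiv ℂ F z a) (fderiv ℂ F z b) := by
  have hFz : DifferentiableAt ℂ F z := hF.differentiableAt two_ne_zero
  have hev : (fun w => dBar (toC ρ) w b) =ᶠ[𝓝 z]
      fun w => ∑ j, star (fderiv ℂ F w b j) * star (delCoeff ρ' (F w) j) := by
    have h1 : ∀ᶠ w in 𝓝 z, ContDiffAt ℂ 2 F w := hF.eventually (by simp)
    have h2 : ∀ᶠ w in 𝓝 z, ContDiffAt ℝ 2 ρ' (F w) :=
      hF.continuousAt.eventually (hρ'.eventually (by simp))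
    filter_upwards [hρ.eventually_nhds, h1, h2] with w hw hw1 hw2
    have he : toC ρ =ᶠ[𝓝 w] fun v => toC ρ' (F v) := hw.mono fun v hv => by simp [toC, hv]
    rw [dBar_apply, he.fderiv_eq, ← dBar_apply, dBar_comp_holomorphic
      (hw1.differentiableAt two_ne_zero) ((contDiffAt_toC hw2).differentiableAt two_ne_zero),
      dBar_toC_eq_sum]
  have hFd : DifferentiableAt ℂ (fderiv ℂ F) z :=
    (hF.fderiv_right (m := 1) (by norm_num)).differentiableAt one_ne_zero
  have hAj : ∀ j, DifferentiableAt ℂ (fun w => fderiv ℂ F w b j) z := fun j =>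
    differentiableAt_pi.1 (hFd.clm_apply (differentiableAt_const b)) j
  have hAj' : ∀ j, DifferentiableAt ℝ (fun w => star (fderiv ℂ F w b j)) z := fun j =>
    differentiableAt_star ((hAj j).restrictScalars ℝ)
  have hq : ∀ j, DifferentiableAt ℝ (fun w => star (delCoeff ρ' w j)) (F z) := fun j =>
    (contDiffAt_star (contDiffAt_delCoeff hρ' j)).differentiableAt one_ne_zero
  have hqF : ∀ j, DifferentiableAt ℝ (fun w => star (delCoeff ρ' (F w) j)) z := fun j =>
    (hq j).comp z (hFz.restrictScalars ℝ)
  rw [deldelbar_eq, deldelbar_eq, dHol_apply, hev.fderiv_eq, ← dHol_apply,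
    dHol_sum fun j => (hAj' j).fun_mul (hqF j), dHol_dBar_toC hρ']
  refine Finset.sum_congr rfl fun j _ => ?_
  rw [dHol_mul (hAj' j) (hqF j), dHol_star_holomorphic (hAj j),
    dHol_comp_holomorphic (g := fun w => star (delCoeff ρ' w j)) hFz (hq j), zero_mul, zero_add]

/-- Invariance of `β` under holomorphic changes of coordinates. The one-form `α' - α''` is invariant
because `∂∂̄ρ` is, and the pull-back of `∑ᵢ Fᵢ dGᵢ` is a form of the same kind, so that its exterior
derivative can be computed in either coordinates. -/
theorem betaLocal_comp_holomorphic {ρ ρ' : Cn n → ℝ} {L L' : Cn n → Cn n} {V V' W : Set (Cn n)}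
    (h : IsTransverse ρ L V) (h' : IsTransverse ρ' L' V') (hW : IsOpen W) (hWV : W ⊆ V)
    (hWV' : Set.MapsTo F W V') (hF : ContDiffOn ℂ 2 F W) (hρ : ∀ w ∈ W, ρ w = ρ' (F w))
    (hL : ∀ w ∈ W, fderiv ℂ F w (L w) = L' (F w)) (hz : z ∈ W) (x y : Cn n) :
    betaLocal ρ L z x y = betaLocal ρ' L' (F z) (fderiv ℂ F z x) (fderiv ℂ F z y) := by
  have hFw : ∀ w ∈ W, ContDiffAt ℂ 2 F w := fun w hw => hF.contDiffAt (hW.mem_nhds hw)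
  have hFd : ∀ w ∈ W, DifferentiableAt ℂ F w := fun w hw =>
    (hFw w hw).differentiableAt two_ne_zero
  have hFR : ContDiffOn ℝ 1 F W := (hF.restrict_scalars ℝ).of_le one_le_two
  have hd : ∀ {f : Cn n → ℂ} {w}, w ∈ W → ContDiffOn ℝ 1 f V' → DifferentiableAt ℝ f (F w) :=
    fun hw hf => (hf.contDiffAt (h'.isOpen.mem_nhds (hWV' hw))).differentiableAt one_ne_zero
  have key := formTwo_eq_of_formOne_eq hW
    (F := potentialLeft ρ L) (G := potentialRight ρ)
    (F' := fun i w => potentialLeft ρ' L' i (F w)) (G' := fun i w => potentialRight ρ' i (F w))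
    (fun i => (h.contDiffOn_potentialLeft i).mono hWV)
    (fun i => (h.contDiffOn_potentialRight i).mono hWV)
    (fun i => (h'.contDiffOn_potentialLeft i).comp hFR hWV')
    (fun i => (h'.contDiffOn_potentialRight i).comp hFR hWV')
    (fun w hw a => by
      have e : formOne (fun i w => potentialLeft ρ' L' i (F w))
          (fun i w => potentialRight ρ' i (F w)) w a
          = formOne (potentialLeft ρ' L') (potentialRight ρ') (F w) (fderiv ℂ F w a) :=
        Finset.sum_congr rfl fun i _ => by
          rw [fderiv_comp_holomorphic (hFd w hw) (hd hw (h'.contDiffOn_potentialRight i))]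
      have hev : ∀ᶠ v in 𝓝 w, ρ v = ρ' (F v) := Filter.mem_of_superset (hW.mem_nhds hw) hρ
      rw [e, h.formOne_potential (hWV hw), h'.formOne_potential (hWV' hw), alphaDiff, alphaDiff,
        deldelbar_comp_holomorphic (hFw w hw) (h'.contDiffAt (hWV' hw)) hev,
        deldelbar_comp_holomorphic (hFw w hw) (h'.contDiffAt (hWV' hw)) hev, hL w hw])
    hz (Complex.I • x) (Complex.I • y)
  rw [betaLocal, betaLocal, dAlphaDiff, dAlphaDiff, key]
  congr 2
  rw [← map_smul, ← map_smul]
  exact Finset.sum_congr rfl fun i _ => by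
    simp only [fderiv_comp_holomorphic (hFd z hz) (hd hz (h'.contDiffOn_potentialRight i)),
      fderiv_comp_holomorphic (hFd z hz) (hd hz (h'.contDiffOn_potentialLeft i))]

end CoordinateChange

/-! ### Charts of a complex manifold -/

section Charts

variable {n : ℕ} {M : Type*} [TopologicalSpace M]

theorem isOpen_transition_source (φ ψ : OpenPartialHomeomorph M (Cn n)) :
    IsOpen (φ.target ∩ φ.symm ⁻¹' ψ.source) :=
  φ.isOpen_inter_preimage_symm ψ.open_source

theorem isOpen_chartDomain (φ : OpenPartialHomeomorph M (Cn n)) {U : Set M} (hU : IsOpen U) :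
    IsOpen (chartDomain φ U) :=
  φ.isOpen_inter_preimage_symm hU

variable [ChartedSpace (Cn n) M] {φ ψ : OpenPartialHomeomorph M (Cn n)} {z : Cn n}

theorem contDiffOn_transition (hφ : φ ∈ holCharts n M) (hψ : ψ ∈ holCharts n M) :
    ContDiffOn ℂ ω (ψ ∘ φ.symm) (φ.target ∩ φ.symm ⁻¹' ψ.source) := by
  have h := (contDiffGroupoid ω 𝓘(ℂ, Cn n)).compatible_of_mem_maximalAtlas hφ hψ
  have h1 := (mem_groupoid_of_pregroupoid.1 h).1
  simpa [contDiffPregroupoid] using h1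

theorem herm_matrix (g : HermitianMetric n M) (φ : OpenPartialHomeomorph M (Cn n)) (z a b : Cn n) :
    herm (g.matrix φ) z a b = g.form (φ.symm z) (coordVec φ z a) (coordVec φ z b) := by
  have hsum : ∀ c : Cn n, coordVec φ z c = ∑ j, c j • coordVec φ z (Pi.single j 1) := fun c => by
    have hc : c = ∑ j, c j • (Pi.single j (1 : ℂ) : Cn n) := by
      ext i; simp [Finset.sum_apply, Pi.single_apply]
    conv_lhs => rw [hc]
    exact (map_sum (mfderiv 𝓘(ℂ, Cn n) 𝓘(ℂ, Cn n) φ.symm z) _ _).trans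
      (Finset.sum_congr rfl fun j _ => map_smul _ _ _)
  conv_rhs => rw [hsum a, hsum b]
  simp only [map_sum, map_smul, map_smulₛₗ, LinearMap.sum_apply, LinearMap.smul_apply, herm,
    smul_eq_mul, HermitianMetric.matrix, Matrix.of_apply, Finset.mul_sum]
  rw [Finset.sum_comm]
  refine Finset.sum_congr rfl fun j _ => Finset.sum_congr rfl fun k _ => ?_
  rw [Complex.star_def]
  ring

theorem form_congr (g : HermitianMetric n M) {p q : M} (h : p = q) (u v : Cn n) : g.form p u v = g.form q u v := by
  subst h; rfl

theorem contDiffAt_transition (hφ : φ ∈ holCharts n M) (hψ : ψ ∈ holCharts n M)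
    (hz : z ∈ φ.target) (hz' : φ.symm z ∈ ψ.source) : ContDiffAt ℂ 2 (ψ ∘ φ.symm) z :=
  ((contDiffOn_transition hφ hψ).contDiffAt
    ((isOpen_transition_source φ ψ).mem_nhds ⟨hz, hz'⟩)).of_le (by simp)

theorem differentiableAt_transition (hφ : φ ∈ holCharts n M) (hψ : ψ ∈ holCharts n M)
    (hz : z ∈ φ.target) (hz' : φ.symm z ∈ ψ.source) : DifferentiableAt ℂ (ψ ∘ φ.symm) z :=
  (contDiffAt_transition hφ hψ hz hz').differentiableAt two_ne_zero

theorem fderiv_transition_comp {χ : OpenPartialHomeomorph M (Cn n)} (hφ : φ ∈ holCharts n M)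
    (hψ : ψ ∈ holCharts n M) (hχ : χ ∈ holCharts n M) (hz : z ∈ φ.target)
    (hψz : φ.symm z ∈ ψ.source) (hχz : φ.symm z ∈ χ.source) (a : Cn n) :
    fderiv ℂ (χ ∘ ψ.symm) (ψ (φ.symm z)) (fderiv ℂ (ψ ∘ φ.symm) z a)
      = fderiv ℂ (χ ∘ φ.symm) z a := by
  have h1 := differentiableAt_transition hφ hψ hz hψz
  have h2 : DifferentiableAt ℂ (χ ∘ ψ.symm) ((ψ ∘ φ.symm) z) :=
    differentiableAt_transition hψ hχ (ψ.map_source hψz)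
      (by rwa [Function.comp_apply, ψ.left_inv hψz])
  have hev : χ ∘ φ.symm =ᶠ[𝓝 z] (χ ∘ ψ.symm) ∘ (ψ ∘ φ.symm) := by
    filter_upwards [(isOpen_transition_source φ ψ).mem_nhds ⟨hz, hψz⟩] with w hw
    simp [ψ.left_inv hw.2]
  rw [hev.fderiv_eq, fderiv_comp z h2 h1]
  rfl

theorem fderiv_transition_inverse (hφ : φ ∈ holCharts n M) (hψ : ψ ∈ holCharts n M)
    (hz : z ∈ φ.target) (hψz : φ.symm z ∈ ψ.source) (a : Cn n) :
    fderiv ℂ (φ ∘ ψ.symm) (ψ (φ.symm z)) (fderiv ℂ (ψ ∘ φ.symm) z a) = a := by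
  rw [fderiv_transition_comp hφ hψ hφ hz hψz (φ.map_target hz)]
  have hev : φ ∘ φ.symm =ᶠ[𝓝 z] id := by
    filter_upwards [φ.open_target.mem_nhds hz] with w hw
    simp [φ.right_inv hw]
  rw [hev.fderiv_eq, fderiv_id]
  rfl

variable [IsManifold 𝓘(ℂ, Cn n) ω M]

/-- The tangent space at `p` is identified with `ℂⁿ` through the preferred chart at `p`. -/
theorem coordVec_eq (hφ : φ ∈ holCharts n M) (hz : z ∈ φ.target) (a : Cn n) :
    (coordVec φ z a : Cn n) = fderiv ℂ (chartAt (Cn n) (φ.symm z) ∘ φ.symm) z a := by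
  have hd : MDifferentiableAt 𝓘(ℂ, Cn n) 𝓘(ℂ, Cn n) φ.symm z :=
    ((contMDiffOn_symm_of_mem_maximalAtlas hφ).contMDiffAt
      (φ.open_target.mem_nhds hz)).mdifferentiableAt (by simp)
  have h : (coordVec φ z a : Cn n) = fderivWithin ℂ
      (writtenInExtChartAt 𝓘(ℂ, Cn n) 𝓘(ℂ, Cn n) z φ.symm) (Set.range 𝓘(ℂ, Cn n))
      (extChartAt 𝓘(ℂ, Cn n) z z) a :=
    congrArg (fun A : Cn n →L[ℂ] Cn n => A a) hd.mfderiv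
  refine h.trans ?_
  simp only [writtenInExtChartAt, Function.comp_def, mfld_simps, fderivWithin_univ]
  -- the remaining occurrences of `chartAt` on the model space are the identity by definition
  rfl

theorem chartAt_mem_holCharts (p : M) : chartAt (Cn n) p ∈ holCharts n M :=
  IsManifold.chart_mem_maximalAtlas p

theorem coordVec_transition (hφ : φ ∈ holCharts n M) (hψ : ψ ∈ holCharts n M)
    (hz : z ∈ φ.target) (hψz : φ.symm z ∈ ψ.source) (a : Cn n) :
    (coordVec φ z a : Cn n) = coordVec ψ (ψ (φ.symm z)) (fderiv ℂ (ψ ∘ φ.symm) z a) := by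
  rw [coordVec_eq hφ hz, coordVec_eq hψ (ψ.map_source hψz), ψ.left_inv hψz,
    fderiv_transition_comp hφ hψ (chartAt_mem_holCharts _) hz hψz (mem_chart_source _ _)]

theorem eq_zero_of_coordVec_eq_zero (hφ : φ ∈ holCharts n M) (hz : z ∈ φ.target) {a : Cn n}
    (h : coordVec φ z a = 0) : a = 0 := by
  have h' : fderiv ℂ (chartAt (Cn n) (φ.symm z) ∘ φ.symm) z a = 0 :=
    (coordVec_eq hφ hz a).symm.trans h
  rw [← fderiv_transition_inverse hφ (chartAt_mem_holCharts (φ.symm z)) hz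
    (mem_chart_source _ _) a, h', map_zero]

variable (g : HermitianMetric n M)

theorem isHermitianMatrixField_matrix (hφ : φ ∈ holCharts n M) {V : Set (Cn n)}
    (hV : V ⊆ φ.target) : IsHermitianMatrixField (g.matrix φ) V where
  contDiffOn j k := (g.contDiff φ hφ j k).mono hV
  isHermitian z _ := by
    ext j k
    exact (g.herm_symm (φ.symm z) (coordVec φ z (Pi.single k 1))
      (coordVec φ z (Pi.single j 1))).symm
  pos z hz a ha := by
    rw [herm_matrix]
    exact g.pos _ _ fun h => ha (eq_zero_of_coordVec_eq_zero hφ (hV hz) h)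

theorem herm_matrix_transition (hφ : φ ∈ holCharts n M) (hψ : ψ ∈ holCharts n M)
    (hz : z ∈ φ.target) (hψz : φ.symm z ∈ ψ.source) (a b : Cn n) :
    herm (g.matrix ψ) (ψ (φ.symm z)) (fderiv ℂ (ψ ∘ φ.symm) z a) (fderiv ℂ (ψ ∘ φ.symm) z b)
      = herm (g.matrix φ) z a b := by
  rw [herm_matrix, herm_matrix]
  refine (form_congr g (ψ.left_inv hψz) _ _).trans ?_
  rw [← coordVec_transition hφ hψ hz hψz, ← coordVec_transition hφ hψ hz hψz]

variable {g} {Ω U : Set M} {r : M → ℝ}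

theorem isTransverse_inChart (hr : IsDefiningFunction n Ω U r) (hadm : g.IsAdmissible U r)
    (hφ : φ ∈ holCharts n M) :
    IsTransverse (inChart φ r) (vecL (g.matrix φ) (inChart φ r)) (chartDomain φ U) :=
  (isHermitianMatrixField_matrix g hφ Set.inter_subset_left).isTransverse
    (isOpen_chartDomain φ hr.isOpen) (hr.contDiffOn φ hφ) (hr.fderiv_ne_zero φ hφ) (hadm φ hφ)

/-- The field `L` does not depend on the coordinates. -/
theorem fderiv_transition_vecL (hr : IsDefiningFunction n Ω U r) (hφ : φ ∈ holCharts n M)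
    (hψ : ψ ∈ holCharts n M) (hz : z ∈ φ.target) (hψz : φ.symm z ∈ ψ.source)
    (hU : φ.symm z ∈ U) :
    fderiv ℂ (ψ ∘ φ.symm) z (vecL (g.matrix φ) (inChart φ r) z)
      = vecL (g.matrix ψ) (inChart ψ r) (ψ (φ.symm z)) := by
  have hGφ := isHermitianMatrixField_matrix g hφ subset_rfl
  have hGψ := isHermitianMatrixField_matrix g hψ subset_rfl
  have hz' : ψ (φ.symm z) ∈ ψ.target := ψ.map_source hψz
  have hdψ : DifferentiableAt ℝ (toC (inChart ψ r)) ((ψ ∘ φ.symm) z) :=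
    (contDiffAt_toC ((hr.contDiffOn ψ hψ).contDiffAt ((isOpen_chartDomain ψ hr.isOpen).mem_nhds
      ⟨hz', by rwa [Set.mem_preimage, ψ.left_inv hψz]⟩))).differentiableAt
        two_ne_zero
  have hdF := differentiableAt_transition hφ hψ hz hψz
  have hev : toC (inChart φ r) =ᶠ[𝓝 z] fun w => toC (inChart ψ r) ((ψ ∘ φ.symm) w) := by
    filter_upwards [(isOpen_transition_source φ ψ).mem_nhds ⟨hz, hψz⟩] with w hw
    simp [toC, inChart, ψ.left_inv hw.2]
  have hgrad : fderiv ℂ (ψ ∘ φ.symm) z (gradVec (g.matrix φ) (inChart φ r) z)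
      = gradVec (g.matrix ψ) (inChart ψ r) (ψ (φ.symm z)) := by
    refine hGψ.eq_gradVec hz' fun a => ?_
    have ha := fderiv_transition_inverse hψ hφ hz' (by rw [ψ.left_inv hψz]; exact φ.map_target hz) a
    rw [ψ.left_inv hψz, φ.right_inv hz] at ha
    rw [← ha, herm_matrix_transition g hφ hψ hz hψz, hGφ.herm_gradVec hz,
      ← Function.comp_apply (f := ψ), ← dHol_comp_holomorphic hdF hdψ, dHol_apply, hev.fderiv_eq,
      ← dHol_apply]
  rw [vecL, vecL, map_smul, hgrad, normSqDel, normSqDel, ← hgrad,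
    herm_matrix_transition g hφ hψ hz hψz]

theorem betaLocal_add_left (ρ : Cn n → ℝ) (L : Cn n → Cn n) (z x x' y : Cn n) :
    betaLocal ρ L z (x + x') y = betaLocal ρ L z x y + betaLocal ρ L z x' y := by
  rw [betaLocal, betaLocal, betaLocal, ← Complex.add_re, ← mul_add]
  congr 2
  simp only [dAlphaDiff, formTwo, ← Finset.sum_add_distrib, smul_add, map_add]
  exact Finset.sum_congr rfl fun i _ => by ring

theorem betaLocal_smul_left (ρ : Cn n → ℝ) (L : Cn n → Cn n) (z : Cn n) (c : ℝ) (x y : Cn n) :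
    betaLocal ρ L z (c • x) y = c * betaLocal ρ L z x y := by
  rw [betaLocal, betaLocal, ← Complex.re_ofReal_mul]
  congr 1
  rw [mul_left_comm]
  congr 1
  simp only [dAlphaDiff, formTwo, Finset.mul_sum, smul_comm Complex.I c x, map_smul,
    Complex.real_smul]
  exact Finset.sum_congr rfl fun i _ => by ring

theorem betaLocal_swap (ρ : Cn n → ℝ) (L : Cn n → Cn n) (z x y : Cn n) :
    betaLocal ρ L z y x = -betaLocal ρ L z x y := by
  rw [betaLocal, betaLocal, ← Complex.neg_re, ← mul_neg]
  congr 2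
  simp only [dAlphaDiff, formTwo, ← Finset.sum_neg_distrib]
  exact Finset.sum_congr rfl fun i _ => by ring

/-- `betaLocal` at a point, as an alternating form. -/
def betaAlternating (ρ : Cn n → ℝ) (L : Cn n → Cn n) (z : Cn n) : Cn n [⋀^Fin 2]→ₗ[ℝ] ℝ where
  toFun v := betaLocal ρ L z (v 0) (v 1)
  map_update_add' v i x y := by
    fin_cases i
    · simp [betaLocal_add_left]
    · simp only [Fin.mk_one, Function.update_self, ne_eq, zero_ne_one, not_false_eq_true,
        Function.update_of_ne, betaLocal_swap ρ L z _ (v 0), betaLocal_add_left]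
      ring
  map_update_smul' v i c x := by
    fin_cases i
    · simp [betaLocal_smul_left]
    · simp only [Fin.mk_one, Function.update_self, ne_eq, zero_ne_one, not_false_eq_true,
        Function.update_of_ne, betaLocal_swap ρ L z _ (v 0), betaLocal_smul_left, smul_eq_mul]
      ring
  map_eq_zero_of_eq' v i j hij hne := by
    have h : v 0 = v 1 := by
      fin_cases i <;> fin_cases j <;> first | exact absurd rfl hne | exact hij | exact hij.symm
    have := betaLocal_swap ρ L z (v 1) (v 1)
    rw [h]
    linarith

/-- The two-form `β` on the manifold, computed at each point in the preferred chart. -/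
def betaForm (g : HermitianMetric n M) (r : M → ℝ) (p : M) :
    TangentSpace 𝓘(ℂ, Cn n) p [⋀^Fin 2]→ₗ[ℝ] ℝ :=
  betaAlternating (inChart (chartAt (Cn n) p) r)
    (vecL (g.matrix (chartAt (Cn n) p)) (inChart (chartAt (Cn n) p) r)) (chartAt (Cn n) p p)

theorem formInChart_betaForm (hr : IsDefiningFunction n Ω U r) (hadm : g.IsAdmissible U r)
    (hφ : φ ∈ holCharts n M) (hz : z ∈ chartDomain φ U) :
    formInChart (betaForm g r) φ z
      = betaLocal (inChart φ r) (vecL (g.matrix φ) (inChart φ r)) z := by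
  funext a b
  set ψ := chartAt (Cn n) (φ.symm z) with hψdef
  have hψ : ψ ∈ holCharts n M := chartAt_mem_holCharts _
  have hW : IsOpen (φ.target ∩ φ.symm ⁻¹' (ψ.source ∩ U)) :=
    isOpen_chartDomain φ (ψ.open_source.inter hr.isOpen)
  have key := betaLocal_comp_holomorphic (F := ψ ∘ φ.symm) (isTransverse_inChart hr hadm hφ)
    (isTransverse_inChart hr hadm hψ) hW
    (fun w hw => ⟨hw.1, hw.2.2⟩)
    (fun w hw => ⟨ψ.map_source hw.2.1, by
      simpa only [Set.mem_preimage, Function.comp_apply, ψ.left_inv hw.2.1] using hw.2.2⟩)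
    (fun w hw => (contDiffAt_transition hφ hψ hw.1 hw.2.1).contDiffWithinAt)
    (fun w hw => by simp [inChart, ψ.left_inv hw.2.1])
    (fun w hw => fderiv_transition_vecL hr hφ hψ hw.1 hw.2.1 hw.2.2)
    (z := z) ⟨hz.1, mem_chart_source _ _, hz.2⟩ a b
  rw [key]
  have ha := coordVec_eq hφ hz.1 a
  have hb := coordVec_eq hφ hz.1 b
  exact congrArg₂ (betaLocal (inChart ψ r) (vecL (g.matrix ψ) (inChart ψ r)) (ψ (φ.symm z))) ha hb

end Charts

end

theorem proposition6p1 (n : ℕ) (hn : 2 ≤ n) {M : Type*} [TopologicalSpace M] [T2Space M]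
    [SecondCountableTopology M] [ChartedSpace (Cn n) M] [IsManifold 𝓘(ℂ, Cn n) ω M]
    (g : HermitianMetric n M) (Ω U : Set M) (hΩ : IsRelCompactDomain Ω)
    (hpsc : IsLeviPseudoconvex n Ω) (r : M → ℝ) (hr : IsDefiningFunction n Ω U r)
    (hadm : g.IsAdmissible U r) :
    ∃ β : ∀ p : M, TangentSpace 𝓘(ℂ, Cn n) p [⋀^Fin 2]→ₗ[ℝ] ℝ,
      (∀ φ ∈ holCharts n M,
        (∀ a b : Cn n, ContinuousOn (fun z => formInChart β φ z a b) (chartDomain φ U)) ∧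
        WeakBetaEq (chartDomain φ U) (alphaForm (g.matrix φ) (inChart φ r)) (formInChart β φ)) ∧
      ∀ φ ∈ holCharts n M, ∀ z ∈ chartDomain φ (frontier Ω),
        ∀ a ∈ leviNull (inChart φ r) z, ∀ b ∈ leviNull (inChart φ r) z,
          complexify (formInChart β φ z) (CVec.ofHol a) (CVec.ofHol b) = 0 ∧
          ∃ h : ℂ,
            HasThirdHess (g.matrix φ) (toC (inChart φ r)) (vecX (g.matrix φ) (inChart φ r)) z
              (CVec.ofHol a) (CVec.ofHol b).conj h ∧
            complexify (formInChart β φ z) (CVec.ofHol a) (CVec.ofHol b).conj =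
              -Complex.I * h
              - Complex.I * alphaForm (g.matrix φ) (inChart φ r) z (CVec.ofHol a)
                * alphaForm (g.matrix φ) (inChart φ r) z (CVec.ofHol b).conj
              + Complex.I
                * hess (g.matrix φ) (toC (inChart φ r)) z
                    (CVec.ofReal (vecX (g.matrix φ) (inChart φ r) z)) (CVec.ofHol a)
                * alphaForm (g.matrix φ) (inChart φ r) z (CVec.ofHol b).conj
              + Complex.I * alphaForm (g.matrix φ) (inChart φ r) z (CVec.ofHol a)
                * hess (g.matrix φ) (toC (inChart φ r)) z
                    (CVec.ofReal (vecX (g.matrix φ) (inChart φ r) z)) (CVec.ofHol b).conj := by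
  refine ⟨betaForm g r, fun φ hφ => ?_, fun φ hφ z hz a ha b hb => ?_⟩
  · have ht := isTransverse_inChart hr hadm hφ
    refine ⟨fun a b => (ht.continuousOn_betaLocal a b).congr fun z hz => ?_,
      fun χ hχ hc hs u v => ?_⟩
    · rw [formInChart_betaForm hr hadm hφ hz]
    · refine Eq.trans ?_ (ht.weakBetaEq χ hχ hc hs u v)
      refine integral_congr_ae (Eventually.of_forall fun z => ?_)
      by_cases hz : z ∈ tsupport χ
      · simp only [formInChart_betaForm hr hadm hφ (hs hz)]
      · simp [image_eq_zero_of_notMem_tsupport hz]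
  · have ht := isTransverse_inChart hr hadm hφ
    have hzU : z ∈ chartDomain φ U := ⟨hz.1, hr.frontier_subset hz.2⟩
    rw [formInChart_betaForm hr hadm hφ hzU]
    exact ⟨ht.complexify_betaLocal_ofHol hzU ha hb, exists_hasThirdHess ht hzU ha hb⟩
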